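/- **Theorem ($N$-soliton solution of the semi-discrete Degasperis–Procesi equation).** Let $N\ge 0$ be an integer, let $a,b\in\mathbb C$, and let $p_i,\xi_{i0},C_i\in\mathbb C$ $(i=1,\dots,2N)$ satisfy $p_i\neq0$, $p_i+p_j\ne0$ for $i\neq j$, $1-ap_i\neq0$, $1\pm bp_i\ne0$, $C_{2N+1-i}=C_i$, and the reduction condition $$p_i(1-a^2p_i^2)(1-b^2p_{2N+1-i}^2)+p_{2N+1-i}(1-a^2p_{2N+1-i}^2)(1-b^2p_i^2)=0\qquad(i=1,\dots,N).$$ For $k\in\{0,1\}$, $l\in\mathbb Z$ and $s\in\mathbb R$ let $f_{kl}(s)=\mathrm{Pf}(1,2,\dots,2N)_{kl}$ be the pfaffian with entries $$(i,j)_{kl}=c_{ij}+\frac{p_i-p_j}{p_i+p_j}\,\varphi_i^{(0)}(k,l)\,\varphi_j^{(0)}(k,l),\qquad c_{ij}=2p_i\,C_i\,\delta_{j,2N+1-i}\,\frac{1+ap_i}{1-ap_j}\,\frac{1-bp_j}{1+bp_i},$$ $$\varphi_i^{(n)}(k,l)=p_i^n\Big(\frac{1+ap_i}{1-ap_i}\Big)^k\Big(\frac{1+bp_i}{1-bp_i}\Big)^l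 e^{p_i^{-1}s+\xi_{i0}}$$ (the array is skew-symmetric by the reduction condition). Put $f_l=f_{0l}$, $g_l=f_{1l}$ and $$u_l=\Big(\ln\frac{g_l}{f_l}\Big)_s,\qquad \delta_l=2\,\frac{(a-b)g_{l+1}f_l-(a+b)g_lf_{l+1}}{(a-b)g_{l+1}f_l+(a+b)g_lf_{l+1}},$$ where $(\ln w)_s$ means $w_s/w$. Write $\Delta w_l=(w_{l+1}-w_l)/\delta_l$ and $Mw_l=(w_l+w_{l-1})/2$, and let $$m_l=-\frac{\Delta u_l-\Delta u_{l-1}}{M\delta_l}+\frac{M(\delta_l\,Mu_{l+1})}{M\delta_l}-a .$$ Then $(u_l,\delta_l)$ solves the semi-discrete Degasperis–Procesi system wherever its terms are defined: 1. for every $l\in\mathbb Z$ and $s\in\mathbb R$ at which $f_l,g_l,f_{l+1},g_{l+1}$ and the denominator of $\delta_l$ do not vanish, $\delta_l$ is differentiable and $$\frac{d\delta_l}{ds}=\Big(1-\frac{\delta_l^2}{4}\Big)(u_{l+1}-u_l);$$ 2. for every $l\in\mathbb Z$ and $s\in\mathbb R$ at which $f_j,g_j$ $(j=l-1,l,l+1)$,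 the denominators of $\delta_{l-1}$ and $\delta_l$, and $\delta_{l-1},\ \delta_l,\ \delta_{l-1}+\delta_l$ do not vanish, $m_l$ is differentiable and nonzero, and $$\frac{d\ln m_l}{ds}=-2M\Delta u_l-\frac{M(\delta_l\Delta u_l)}{M\delta_l}+\frac{\delta_l(Mu_{l+1}-a)-\delta_{l-1}(Mu_l-a)}{2}+\frac{M\big(\delta_l^2(u_{l+1}-u_l)\big)}{4M\delta_l}.$$ -/

import Mathlib

noncomputable section

/-- The pfaffian `Pf(1, 2, …, 2N)` of a skew-symmetric array `A`, given by
`Pf A = 1 / (2 ^ N N!) * ∑ σ, sgn σ * ∏ m, A (σ (2 m - 1)) (σ (2 m))`, the sum being over all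
permutations of `2N` letters (numbered here from `0`). -/
def pfaffian {N : ℕ} (A : Fin (2 * N) → Fin (2 * N) → ℂ) : ℂ :=
  (1 / ((2 : ℂ) ^ N * (N.factorial : ℂ))) *
    ∑ σ : Equiv.Perm (Fin (2 * N)), ((Equiv.Perm.sign σ : ℤ) : ℂ) *
      ∏ m : Fin N, A (σ ⟨2 * (m : ℕ), by omega⟩) (σ ⟨2 * (m : ℕ) + 1, by omega⟩)

namespace SemiDiscreteDP

/-! ### The tau functions

The index `2N + 1 - i` attached to `i ∈ {1, …, 2N}` is `Fin.rev i`. -/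

section Tau

variable {N : ℕ} (a b : ℂ) (p ξ C : Fin (2 * N) → ℂ)

/-- `φ_i^{(n)}(k, l)` as a function of the time `s`. -/
def phi (i : Fin (2 * N)) (n k l : ℤ) (s : ℝ) : ℂ :=
  p i ^ n * ((1 + a * p i) / (1 - a * p i)) ^ k * ((1 + b * p i) / (1 - b * p i)) ^ l *
    Complex.exp ((p i)⁻¹ * (s : ℂ) + ξ i)

/-- The constants `c_{ij} = 2 p_i C_{ij} (1 + a p_i) / (1 - a p_j) * (1 - b p_j) / (1 + b p_i)`,
where `C_{ij} = δ_{j, 2N+1-i} C_i`. -/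
def cCoeff (i j : Fin (2 * N)) : ℂ :=
  2 * p i * (if j = Fin.rev i then C i else 0) *
    ((1 + a * p i) / (1 - a * p j)) * ((1 - b * p j) / (1 + b * p i))

/-- The pfaffian entry `(i, j)_{kl}`. -/
def entry (k l : ℤ) (s : ℝ) (i j : Fin (2 * N)) : ℂ :=
  cCoeff a b p C i j +
    (p i - p j) / (p i + p j) * phi a b p ξ i 0 k l s * phi a b p ξ j 0 k l s

/-- The pfaffian `f_{kl}` as a function of the time `s`. -/
def tau (k l : ℤ) (s : ℝ) : ℂ := pfaffian (entry a b p ξ C k l s)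

/-- `f_l = f_{0l}`. -/
def fTau (l : ℤ) (s : ℝ) : ℂ := tau a b p ξ C 0 l s

/-- `g_l = f_{1l}`. -/
def gTau (l : ℤ) (s : ℝ) : ℂ := tau a b p ξ C 1 l s

end Tau

/-! ### The change of variables -/

/-- `u_l = (ln (g_l / f_l))_s`; for complex-valued functions the derivative of the logarithm is
the logarithmic derivative, independent of any choice of branch. -/
def uOf (f g : ℤ → ℝ → ℂ) (l : ℤ) : ℝ → ℂ := logDeriv fun s => g l s / f l s

/-- The denominator `(a - b) g_{l+1} f_l + (a + b) g_l f_{l+1}` of the hodograph variable. -/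
def hodographDen (a b : ℂ) (f g : ℤ → ℝ → ℂ) (l : ℤ) (s : ℝ) : ℂ :=
  (a - b) * g (l + 1) s * f l s + (a + b) * g l s * f (l + 1) s

/-- The discrete hodograph variable `δ_l`. -/
def deltaOf (a b : ℂ) (f g : ℤ → ℝ → ℂ) (l : ℤ) (s : ℝ) : ℂ :=
  2 * (((a - b) * g (l + 1) s * f l s - (a + b) * g l s * f (l + 1) s) /
    hodographDen a b f g l s)

/-! ### The semi-discrete Degasperis-Procesi system -/

/-- The difference operator `Δ w_l = (w_{l+1} - w_l) / δ_l` on the mesh `δ`. -/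
def diffOp (δ w : ℤ → ℂ) (l : ℤ) : ℂ := (w (l + 1) - w l) / δ l

/-- The averaging operator `M w_l = (w_l + w_{l-1}) / 2`. -/
def avgOp (w : ℤ → ℂ) (l : ℤ) : ℂ := (w l + w (l - 1)) / 2

/-- The momentum variable
`m_l = - (Δ u_l - Δ u_{l-1}) / M δ_l + M (δ_l M u_{l+1}) / M δ_l - a`. -/
def momentum (a : ℂ) (u δ : ℤ → ℂ) (l : ℤ) : ℂ :=
  -(diffOp δ u l - diffOp δ u (l - 1)) / avgOp δ l +
    avgOp (fun j => δ j * avgOp u (j + 1)) l / avgOp δ l - a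

/-- The right-hand side of the evolution equation of `ln m_l`:
`- 2 M Δ u_l - M (δ_l Δ u_l) / M δ_l + (δ_l (M u_{l+1} - a) - δ_{l-1} (M u_l - a)) / 2
  + M (δ_l² (u_{l+1} - u_l)) / (4 M δ_l)`. -/
def momentumRHS (a : ℂ) (u δ : ℤ → ℂ) (l : ℤ) : ℂ :=
  -2 * avgOp (diffOp δ u) l - avgOp (fun j => δ j * diffOp δ u j) l / avgOp δ l +
    (δ l * (avgOp u (l + 1) - a) - δ (l - 1) * (avgOp u l - a)) / 2 +
    avgOp (fun j => δ j ^ 2 * (u (j + 1) - u j)) l / (4 * avgOp δ l)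

/-- The mesh equation `dδ_l/ds = (1 - δ_l² / 4) (u_{l+1} - u_l)` at the site `l` and time `s`. -/
def MeshEquation (u δ : ℤ → ℝ → ℂ) (l : ℤ) (s : ℝ) : Prop :=
  HasDerivAt (δ l) ((1 - δ l s ^ 2 / 4) * (u (l + 1) s - u l s)) s

/-- The momentum equation `d ln m_l / ds = momentumRHS` at the site `l` and time `s`, with `m_l`
given by `momentum`; it includes that `m_l` is differentiable and does not vanish at `s`. -/
def MomentumEquation (a : ℂ) (u δ : ℤ → ℝ → ℂ) (l : ℤ) (s : ℝ) : Prop :=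
  let m : ℝ → ℂ := fun t => momentum a (fun j => u j t) (fun j => δ j t) l
  DifferentiableAt ℝ m s ∧ m s ≠ 0 ∧
    logDeriv m s = momentumRHS a (fun j => u j s) (fun j => δ j s) l

/-- At time `s`, the logarithms of `g_l / f_l` and of `g_{l+1} / f_{l+1}` and the quotient
defining `δ_l` make sense. -/
def RegularAt (a b : ℂ) (f g : ℤ → ℝ → ℂ) (l : ℤ) (s : ℝ) : Prop :=
  f l s ≠ 0 ∧ g l s ≠ 0 ∧ f (l + 1) s ≠ 0 ∧ g (l + 1) s ≠ 0 ∧ hodographDen a b f g l s ≠ 0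

end SemiDiscreteDP

end

noncomputable section

open Matrix Filter Topology

/-! Let A be the array of f_l, φ its vector φ_i^{(0)}(0,l), and T_a φ the vector with entries φ_i
(1+a p_i)/(1-a p_i). Raising k from 0 to 1 applies T_a to φ, and moving l by ±1 applies T_{±b}. Each
shift changes A by a skew rank-two matrix x yᵀ - y xᵀ, so `pfaffian_add_vecMulVec_sub_vecMulVec`
expresses neighbouring tau functions as f_l times scalars built from forms xᵀA⁻¹y. Since φ' = φ/p,
A' is again skew of rank two, so differentiation stays within a few such forms and bilinear
equations become polynomial identities between scalars.

Two equations are needed. `miwa_bilinear` relates f_l, g_l, f_{l+1}, g_{l+1} and uses only the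
skewness of c. `hodograph_bilinear` uses the full reduction: with E_l the numerator (a-b)g_{l+1}f_l
- (a+b)g_l f_{l+1}, it reads E_{l-1}'E_l - E_{l-1}E_l' + 2bE_{l-1}E_l = 8b³(f_l g_l)². For this, put
M = A + (T_a φ)φᵀ, κ = φ + T_a φ and η_b = φ(1+ap)/(1-bp). Then E_l and E_{l-1} are -2b f_l g_l
times det(M - κη_{±b}ᵀ)/det M, and M' has rank one. The reduction condition makes a rank-two update
of M similar to Mᵀ through a diagonal matrix; equality of the two determinants is the required
Wronskian relation.

The mesh equation is formal, valid for any differentiable f and g. For the momentum equation, the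
two bilinear equations give m_l = 16b³(f_l g_l)²/(E_{l-1}E_l(δ_l+δ_{l-1})), which is then
differentiated logarithmically. -/

/-! ### Pfaffians under congruence. -/

/-- A product over `Fin (2 * N)` grouped into consecutive pairs. -/
theorem prod_fin_two_mul {N : ℕ} (F : Fin (2 * N) → ℂ) :
    ∏ i, F i = ∏ m : Fin N, F ⟨2 * (m : ℕ), by omega⟩ * F ⟨2 * (m : ℕ) + 1, by omega⟩ := by
  rw [← Equiv.prod_comp (finProdFinEquiv.trans (finCongr (Nat.mul_comm N 2))) F,
    Fintype.prod_prod_type]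
  refine Finset.prod_congr rfl fun m _ => ?_
  rw [Fin.prod_univ_two]
  congr 2 <;> (ext; simp [finProdFinEquiv]; try omega)

/-- Functions on `Fin (2 * N)` as functions into pairs. -/
def pairsEquiv (N : ℕ) (α : Type) : (Fin (2 * N) → α) ≃ (Fin N → α × α) where
  toFun h m := (h ⟨2 * (m : ℕ), by omega⟩, h ⟨2 * (m : ℕ) + 1, by omega⟩)
  invFun k i := if (i : ℕ) % 2 = 0 then (k ⟨i / 2, by omega⟩).1 else (k ⟨i / 2, by omega⟩).2
  left_inv h := by
    funext i
    by_cases hi : (i : ℕ) % 2 = 0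
    · simp only [hi, if_true]
      congr 1; ext; simp; omega
    · simp only [hi, if_false]
      congr 1; ext; simp; omega
  right_inv k := by
    funext m
    have h1 : 2 * (m : ℕ) / 2 = m := by omega
    have h2 : (2 * (m : ℕ) + 1) / 2 = m := by omega
    ext <;> simp [h1, h2]

/-- A sum over self-maps of a finite type whose terms vanish off the bijections. -/
theorem sum_fun_eq_sum_perm {n : Type*} [Fintype n] [DecidableEq n] (F : (n → n) → ℂ)
    (hF : ∀ h, ¬ Function.Injective h → F h = 0) :
    ∑ h, F h = ∑ τ : Equiv.Perm n, F τ := by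
  symm
  refine Finset.sum_of_injOn (fun τ : Equiv.Perm n => (τ : n → n))
    (fun τ _ τ' _ h => DFunLike.coe_injective h) (fun _ _ => Finset.mem_coe.2 (Finset.mem_univ _))
    (fun h _ hh => hF h fun hi => hh ?_) (fun _ _ => rfl)
  exact ⟨Equiv.ofBijective h (Finite.injective_iff_bijective.1 hi), by simp, rfl⟩

/-- `Pf (B A Bᵀ) = det B * Pf A`. -/
theorem pfaffian_mul_mul_transpose {N : ℕ} (B A : Matrix (Fin (2 * N)) (Fin (2 * N)) ℂ) :
    pfaffian (B * A * Bᵀ) = B.det * pfaffian A := by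
  have key : ∀ σ : Equiv.Perm (Fin (2 * N)),
      ∏ m : Fin N, (B * A * Bᵀ) (σ ⟨2 * (m : ℕ), by omega⟩) (σ ⟨2 * (m : ℕ) + 1, by omega⟩) =
        ∑ h : Fin (2 * N) → Fin (2 * N),
          (∏ m : Fin N, A (h ⟨2 * (m : ℕ), by omega⟩) (h ⟨2 * (m : ℕ) + 1, by omega⟩)) *
            ∏ i, B (σ i) (h i) := by
    intro σ
    have h1 : ∀ i j, (B * A * Bᵀ) i j = ∑ k : Fin (2 * N) × Fin (2 * N),
        A k.1 k.2 * (B i k.1 * B j k.2) := by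
      intro i j
      rw [Fintype.sum_prod_type_right]
      simp only [Matrix.mul_apply, transpose_apply, Finset.sum_mul]
      exact Finset.sum_congr rfl fun _ _ => Finset.sum_congr rfl fun _ _ => by ring
    simp only [h1]
    rw [Fintype.prod_sum, ← Equiv.sum_comp (pairsEquiv N (Fin (2 * N)))]
    refine Finset.sum_congr rfl fun h _ => ?_
    rw [prod_fin_two_mul, ← Finset.prod_mul_distrib]
    rfl
  have hdet : ∀ h : Fin (2 * N) → Fin (2 * N),
      ∑ σ : Equiv.Perm (Fin (2 * N)), ((Equiv.Perm.sign σ : ℤ) : ℂ) * ∏ i, B (σ i) (h i) =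
        (B.submatrix id h).det := by
    intro h
    rw [Matrix.det_apply']
    rfl
  unfold pfaffian
  simp only [key, Finset.mul_sum]
  -- For fixed h the sum over σ is the determinant of B with columns selected by h: zero if h
  -- repeats a column, and sgn τ · det B if h is a permutation τ.
  rw [Finset.sum_comm, sum_fun_eq_sum_perm]
  · refine Finset.sum_congr rfl fun τ _ => ?_
    have h2 := hdet τ
    rw [Matrix.det_permute'] at h2
    calc _ = 1 / (2 ^ N * (N.factorial : ℂ)) *
          ((∏ m : Fin N, A (τ ⟨2 * (m : ℕ), by omega⟩) (τ ⟨2 * (m : ℕ) + 1, by omega⟩)) *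
          ∑ σ : Equiv.Perm (Fin (2 * N)), ((Equiv.Perm.sign σ : ℤ) : ℂ) *
            ∏ i, B (σ i) (τ i)) := by
          simp only [Finset.mul_sum]
          exact Finset.sum_congr rfl fun _ _ => by ring
      _ = _ := by rw [h2]; ring
  · intro h hh
    have h0 : (B.submatrix id h).det = 0 := by
      simp only [Function.Injective, not_forall] at hh
      obtain ⟨i, j, hij, hne⟩ := hh
      exact Matrix.det_zero_of_column_eq hne fun k => by simp [hij]
    calc _ = 1 / (2 ^ N * (N.factorial : ℂ)) *
          ((∏ m : Fin N, A (h ⟨2 * (m : ℕ), by omega⟩) (h ⟨2 * (m : ℕ) + 1, by omega⟩)) *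
          ∑ σ : Equiv.Perm (Fin (2 * N)), ((Equiv.Perm.sign σ : ℤ) : ℂ) *
            ∏ i, B (σ i) (h i)) := by
          simp only [Finset.mul_sum]
          exact Finset.sum_congr rfl fun _ _ => by ring
      _ = 0 := by rw [hdet, h0]; ring

/-! ### Low-rank updates and the form xᵀA⁻¹y. -/

/-- The bilinear form `xᵀ A⁻¹ y`. -/
def invForm {n : Type*} [Fintype n] [DecidableEq n] (A : Matrix n n ℂ) (x y : n → ℂ) : ℂ :=
  x ⬝ᵥ (A⁻¹ *ᵥ y)

section InvForm

variable {n : Type*} [Fintype n] [DecidableEq n] (A : Matrix n n ℂ)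

theorem invForm_add_left (x x' y : n → ℂ) :
    invForm A (x + x') y = invForm A x y + invForm A x' y := by simp [invForm]

theorem invForm_add_right (x y y' : n → ℂ) :
    invForm A x (y + y') = invForm A x y + invForm A x y' := by simp [invForm, mulVec_add]

theorem invForm_smul_left (c : ℂ) (x y : n → ℂ) :
    invForm A (c • x) y = c * invForm A x y := by simp [invForm]

theorem invForm_smul_right (c : ℂ) (x y : n → ℂ) :
    invForm A x (c • y) = c * invForm A x y := by simp [invForm, mulVec_smul]

variable {A}

theorem invForm_swap (hA : Aᵀ = -A) (x y : n → ℂ) : invForm A x y = -invForm A y x := by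
  have h : A⁻¹ᵀ = -A⁻¹ := by
    rw [transpose_nonsing_inv, hA]
    by_cases hd : IsUnit A.det
    · exact Matrix.inv_eq_left_inv (by simp [Matrix.nonsing_inv_mul _ hd])
    -- A singular matrix has inverse 0 by convention, so skewness of the form needs no
    -- invertibility.
    · have hd' : ¬ IsUnit (-A).det := by
        rw [Matrix.det_neg]
        intro h; exact hd (isUnit_of_mul_isUnit_right h)
      rw [Matrix.nonsing_inv_apply_not_isUnit _ hd, Matrix.nonsing_inv_apply_not_isUnit _ hd',
        neg_zero]
  unfold invForm
  rw [dotProduct_mulVec, ← mulVec_transpose, h, neg_mulVec, neg_dotProduct, dotProduct_comm]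

theorem invForm_self (hA : Aᵀ = -A) (x : n → ℂ) : invForm A x x = 0 := by
  have := invForm_swap hA x x
  linear_combination this / 2

theorem det_add_vecMulVec (hA : A.det ≠ 0) (x y : n → ℂ) :
    (A + vecMulVec x y).det = A.det * (1 + invForm A y x) := by
  rw [vecMulVec_eq Unit, Matrix.det_add_replicateCol_mul_replicateRow hA.isUnit]
  congr 2
  simp [invForm, Matrix.mul_apply, dotProduct, mulVec, Finset.sum_mul, Finset.mul_sum]
  rw [Finset.sum_comm]
  exact Finset.sum_congr rfl fun _ _ => Finset.sum_congr rfl fun _ _ => by ring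

theorem det_add_vecMulVec_add_vecMulVec (hA : A.det ≠ 0) (x y x' y' : n → ℂ) :
    (A + vecMulVec x y + vecMulVec x' y').det =
      A.det * ((1 + invForm A y x) * (1 + invForm A y' x') -
        invForm A y x' * invForm A y' x) := by
  let U : Matrix n (Fin 2) ℂ := of fun i j => ![x i, x' i] j
  let V : Matrix (Fin 2) n ℂ := ![y, y']
  have hUV : A + vecMulVec x y + vecMulVec x' y' = A + U * V := by
    ext i j
    rw [Matrix.add_apply, Matrix.add_apply, Matrix.add_apply, Matrix.mul_apply, Fin.sum_univ_two,
      add_assoc]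
    rfl
  have hV : ∀ r c, (V * A⁻¹ * U) r c = invForm A (![y, y'] r) (![x, x'] c) := by
    intro r c
    rw [Matrix.mul_assoc]
    have : ∀ i, U i c = ![x, x'] c i := by intro i; fin_cases c <;> rfl
    simp only [invForm, Matrix.mul_apply, dotProduct, mulVec, this]
    rfl
  rw [hUV, Matrix.det_add_mul U V hA.isUnit, Matrix.det_fin_two]
  simp [hV]

end InvForm

/-- This avoids proving det = Pf². If v ≠ 0 is a null vector of A and v_i ≠ 0, then B = 1 - v_i⁻¹
e_i vᵀ is singular while B A Bᵀ = A, so Pf A = det B · Pf A = 0. -/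
theorem det_ne_zero_of_pfaffian_ne_zero {N : ℕ} {A : Matrix (Fin (2 * N)) (Fin (2 * N)) ℂ}
    (hA : Aᵀ = -A) (h : pfaffian A ≠ 0) : A.det ≠ 0 := by
  intro h0
  obtain ⟨v, hv, hvA⟩ := Matrix.exists_vecMul_eq_zero_iff.2 h0
  have hAv : A *ᵥ v = 0 := by
    rw [← vecMul_transpose, hA, vecMul_neg, hvA, neg_zero]
  obtain ⟨i, hi⟩ : ∃ i, v i ≠ 0 := by
    by_contra! hc
    exact hv (funext hc)
  have hB : (1 + vecMulVec (Pi.single i (-(v i)⁻¹)) v).det = 0 := by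
    rw [det_add_vecMulVec (by simp)]
    rw [invForm, inv_one, one_mulVec, dotProduct_single]
    field_simp
    ring
  have := pfaffian_mul_mul_transpose (1 + vecMulVec (Pi.single i (-(v i)⁻¹)) v) A
  rw [hB, zero_mul, transpose_add, transpose_vecMulVec, add_mul, vecMulVec_mul, hvA, mul_add,
    mul_vecMulVec] at this
  simp [hAv] at this
  exact h this

/-- The perturbed matrix is the congruence B A Bᵀ with B = 1 + x zᵀ, zᵀ = yᵀA⁻¹. The quadratic term
vanishes because yᵀA⁻¹y = 0, and det B is the stated factor. -/
theorem pfaffian_add_vecMulVec_sub_vecMulVec {N : ℕ}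
    {A : Matrix (Fin (2 * N)) (Fin (2 * N)) ℂ} (hA : Aᵀ = -A) (hdet : A.det ≠ 0)
    (x y : Fin (2 * N) → ℂ) :
    pfaffian (A + vecMulVec x y - vecMulVec y x) = (1 + invForm A y x) * pfaffian A := by
  have hu := hdet.isUnit
  set z := y ᵥ* A⁻¹ with hz
  have hzA : z ᵥ* A = y := by rw [hz, vecMul_vecMul, nonsing_inv_mul _ hu, vecMul_one]
  have hAz : A *ᵥ z = -y := by
    rw [← vecMul_transpose, hA, vecMul_neg, hzA]
  have hB : (1 + vecMulVec x z).det = 1 + invForm A y x := by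
    rw [det_add_vecMulVec (by simp)]
    simp [invForm, hz, dotProduct_mulVec]
  have hyz : y ⬝ᵥ z = 0 := by
    have h1 : y ⬝ᵥ z = invForm A y y := by
      rw [hz, dotProduct_comm, invForm, dotProduct_mulVec]
    rw [h1, invForm_self hA]
  have hM : (1 + vecMulVec x z) * A * (1 + vecMulVec x z)ᵀ =
      A + vecMulVec x y - vecMulVec y x := by
    rw [transpose_add, transpose_vecMulVec, transpose_one, add_mul, vecMulVec_mul, hzA, one_mul,
      mul_add, mul_one, mul_vecMulVec, add_mulVec, hAz, vecMulVec_mulVec, hyz]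
    ext i j
    simp [vecMulVec_apply]
    ring
  rw [← hM, pfaffian_mul_mul_transpose, hB]

/-! ### Differentiating the form xᵀA⁻¹y. -/

section InvFormDeriv

attribute [local instance] Matrix.linftyOpNormedRing Matrix.linftyOpNormedAlgebra

theorem hasDerivAt_inv_apply {n : Type*} [Fintype n] [DecidableEq n] {A : ℝ → Matrix n n ℂ}
    {A' : Matrix n n ℂ} {s : ℝ} (hA : ∀ i j, HasDerivAt (fun t => A t i j) (A' i j) s)
    (hdet : (A s).det ≠ 0) (i j : n) :
    HasDerivAt (fun t => (A t)⁻¹ i j) (-((A s)⁻¹ * A' * (A s)⁻¹) i j) s := by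
  have hA' : HasDerivAt A A' s := by
    have : HasDerivAt (fun t => (fun i j => A t i j : n → n → ℂ)) A' s :=
      hasDerivAt_pi.2 fun i => hasDerivAt_pi.2 fun j => hA i j
    exact this
  obtain ⟨U, hU⟩ := (Matrix.isUnit_iff_isUnit_det (A s)).2 hdet.isUnit
  have h1 := hasFDerivAt_ringInverse (𝕜 := ℝ) U
  rw [hU] at h1
  have h2 := h1.comp_hasDerivAt s hA'
  have h3 : (↑U⁻¹ : Matrix n n ℂ) = (A s)⁻¹ := by
    rw [← hU, Matrix.coe_units_inv]
  have h4 : HasDerivAt (fun t => (A t)⁻¹) (-((A s)⁻¹ * A' * (A s)⁻¹)) s := by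
    have h5 : (fun t => (A t)⁻¹) = Ring.inverse ∘ A := by
      funext t
      rw [Matrix.nonsing_inv_eq_ringInverse, Function.comp_apply]
    rw [h5]
    refine h2.congr_deriv ?_
    rw [← h3]
    rfl
  have h6 : HasDerivAt (fun t => (fun i j => (A t)⁻¹ i j : n → n → ℂ))
      (-((A s)⁻¹ * A' * (A s)⁻¹)) s := h4
  exact hasDerivAt_pi.1 (hasDerivAt_pi.1 h6 i) j

end InvFormDeriv

theorem hasDerivAt_invForm {n : Type*} [Fintype n] [DecidableEq n] {A : ℝ → Matrix n n ℂ}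
    {A' : Matrix n n ℂ} {x y : ℝ → n → ℂ} {x' y' : n → ℂ} {s : ℝ}
    (hA : ∀ i j, HasDerivAt (fun t => A t i j) (A' i j) s) (hdet : (A s).det ≠ 0)
    (hx : ∀ i, HasDerivAt (fun t => x t i) (x' i) s)
    (hy : ∀ i, HasDerivAt (fun t => y t i) (y' i) s) :
    HasDerivAt (fun t => invForm (A t) (x t) (y t))
      (invForm (A s) x' (y s) + invForm (A s) (x s) y' -
        invForm (A s) (x s) (A' *ᵥ ((A s)⁻¹ *ᵥ y s))) s := by
  have h := HasDerivAt.fun_sum (u := Finset.univ) fun i _ =>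
    (hx i).mul (HasDerivAt.fun_sum (u := Finset.univ) fun j _ =>
      (hasDerivAt_inv_apply hA hdet i j).mul (hy j))
  refine h.congr_deriv ?_
  have h1 : invForm (A s) (x s) (A' *ᵥ ((A s)⁻¹ *ᵥ y s)) =
      x s ⬝ᵥ (((A s)⁻¹ * A' * (A s)⁻¹) *ᵥ y s) := by
    simp [invForm, Matrix.mul_assoc]
  rw [h1]
  simp only [invForm, dotProduct, mulVec, neg_mul, Pi.mul_apply,
    Finset.sum_add_distrib, Finset.sum_neg_distrib,
    mul_add, mul_neg]
  ring

theorem invForm_vecMulVec_mulVec {n : Type*} [Fintype n] [DecidableEq n] (A : Matrix n n ℂ)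
    (x y v w : n → ℂ) :
    invForm A x (vecMulVec v w *ᵥ (A⁻¹ *ᵥ y)) = invForm A x v * invForm A w y := by
  rw [vecMulVec_mulVec]
  simp [invForm, mulVec_smul, mul_comm]

namespace SemiDiscreteDP

/-! ### Pfaffians of Cauchy type -/

section Cauchy

variable {N : ℕ} (c : Fin (2 * N) → Fin (2 * N) → ℂ) (p : Fin (2 * N) → ℂ)

/-- The array `c_{ij} + (p_i - p_j) / (p_i + p_j) * φ_i * φ_j`. -/
def cauchyArray (φ : Fin (2 * N) → ℂ) : Matrix (Fin (2 * N)) (Fin (2 * N)) ℂ :=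
  of fun i j => c i j + (p i - p j) / (p i + p j) * φ i * φ j

/-- The action `φ_i ↦ φ_i (1 + a p_i) / (1 - a p_i)` of a Miwa shift. -/
def miwa (a : ℂ) (φ : Fin (2 * N) → ℂ) : Fin (2 * N) → ℂ :=
  fun i => φ i * ((1 + a * p i) / (1 - a * p i))

variable {c p}

theorem cauchyArray_transpose (hc : ∀ i j, c j i = -c i j) (φ : Fin (2 * N) → ℂ) :
    (cauchyArray c p φ)ᵀ = -cauchyArray c p φ := by
  ext i j
  simp only [cauchyArray, transpose_apply, of_apply, Matrix.neg_apply, hc i j]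
  rw [add_comm (p j), ← neg_sub (p i) (p j)]
  ring

/-- With t_i = (1+a p_i)/(1-a p_i), the kernel satisfies (p_i-p_j)/(p_i+p_j) · (t_i t_j - 1) = t_i -
t_j, an addition law that makes the change rank two. -/
theorem cauchyArray_miwa (hp : ∀ i j, p i + p j ≠ 0) {a : ℂ} (ha : ∀ i, 1 - a * p i ≠ 0)
    (φ : Fin (2 * N) → ℂ) :
    cauchyArray c p (miwa p a φ) =
      cauchyArray c p φ + vecMulVec (miwa p a φ) φ - vecMulVec φ (miwa p a φ) := by
  ext i j
  have := hp i j
  have := ha i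
  have : 1 - p i * a ≠ 0 := by rw [mul_comm]; exact ha i
  have := ha j
  have : 1 - p j * a ≠ 0 := by rw [mul_comm]; exact ha j
  simp only [cauchyArray, miwa, of_apply, Matrix.add_apply, Matrix.sub_apply, vecMulVec_apply]
  field_simp
  ring

theorem cauchyArray_miwa_miwa (hp : ∀ i j, p i + p j ≠ 0) {a b : ℂ}
    (ha : ∀ i, 1 - a * p i ≠ 0) (hb : ∀ i, 1 - b * p i ≠ 0) (φ : Fin (2 * N) → ℂ) :
    cauchyArray c p (miwa p a (miwa p b φ)) =
      cauchyArray c p φ +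
        vecMulVec ((2 * (a + b)) • fun i => φ i * (p i / ((1 - a * p i) * (1 - b * p i))))
          ((1 / 2 : ℂ) • (miwa p a φ + miwa p b φ)) -
        vecMulVec ((1 / 2 : ℂ) • (miwa p a φ + miwa p b φ))
          ((2 * (a + b)) • fun i => φ i * (p i / ((1 - a * p i) * (1 - b * p i)))) := by
  ext i j
  have := hp i j
  have := ha i
  have : 1 - p i * a ≠ 0 := by rw [mul_comm]; exact ha i
  have := ha j
  have : 1 - p j * a ≠ 0 := by rw [mul_comm]; exact ha j
  have := hb i
  have : 1 - p i * b ≠ 0 := by rw [mul_comm]; exact hb i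
  have := hb j
  have : 1 - p j * b ≠ 0 := by rw [mul_comm]; exact hb j
  simp only [cauchyArray, miwa, of_apply, Matrix.add_apply, Matrix.sub_apply, vecMulVec_apply,
    Pi.smul_apply, Pi.add_apply, smul_eq_mul]
  field_simp
  ring

theorem pfaffian_miwa (hc : ∀ i j, c j i = -c i j) (hp : ∀ i j, p i + p j ≠ 0) {a : ℂ}
    (ha : ∀ i, 1 - a * p i ≠ 0) {φ : Fin (2 * N) → ℂ} (hdet : (cauchyArray c p φ).det ≠ 0) :
    pfaffian (cauchyArray c p (miwa p a φ)) =
      (1 + invForm (cauchyArray c p φ) φ (miwa p a φ)) * pfaffian (cauchyArray c p φ) := by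
  rw [cauchyArray_miwa hp ha,
    pfaffian_add_vecMulVec_sub_vecMulVec (cauchyArray_transpose hc φ) hdet]

theorem pfaffian_miwa_miwa (hc : ∀ i j, c j i = -c i j) (hp : ∀ i j, p i + p j ≠ 0) {a b : ℂ}
    (ha : ∀ i, 1 - a * p i ≠ 0) (hb : ∀ i, 1 - b * p i ≠ 0) {φ : Fin (2 * N) → ℂ}
    (hdet : (cauchyArray c p φ).det ≠ 0) :
    (a - b) * pfaffian (cauchyArray c p (miwa p a (miwa p b φ))) =
      (a - b - (a + b) * invForm (cauchyArray c p φ) (miwa p a φ) (miwa p b φ)) *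
        pfaffian (cauchyArray c p φ) := by
  have hA := cauchyArray_transpose hc (p := p) φ
  -- Partial fractions. The factor a - b is kept so that a = b is not excluded; pairing T_a φ + T_b
  -- φ with T_a φ - T_b φ then leaves only the cross term.
  have hx : (a - b) • (fun i => φ i * (p i / ((1 - a * p i) * (1 - b * p i)))) =
      (1 / 2 : ℂ) • (miwa p a φ + (-1 : ℂ) • miwa p b φ) := by
    ext i
    have := ha i
    have : 1 - p i * a ≠ 0 := by rw [mul_comm]; exact ha i
    have := hb i
    have : 1 - p i * b ≠ 0 := by rw [mul_comm]; exact hb i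
    simp only [miwa, Pi.smul_apply, Pi.add_apply, smul_eq_mul]
    field_simp
    ring
  have hx' := congrArg (invForm (cauchyArray c p φ) ((1 / 2 : ℂ) • (miwa p a φ + miwa p b φ))) hx
  rw [cauchyArray_miwa_miwa hp ha hb, pfaffian_add_vecMulVec_sub_vecMulVec hA hdet]
  simp only [invForm_add_left, invForm_add_right, invForm_smul_left, invForm_smul_right,
    invForm_self hA] at hx' ⊢
  rw [invForm_swap hA (miwa p b φ) (miwa p a φ)] at hx'
  linear_combination (2 * (a + b) * pfaffian (cauchyArray c p φ)) * hx'

end Cauchy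

/-! ### The time flow and the first bilinear equation. -/

section Flow

variable {N : ℕ} {c : Fin (2 * N) → Fin (2 * N) → ℂ} {p : Fin (2 * N) → ℂ}
  {φ : ℝ → Fin (2 * N) → ℂ} {s : ℝ}

/-- The factor 1/p_i + 1/p_j produced by the flow cancels the Cauchy denominator p_i + p_j, leaving
rank two. -/
theorem hasDerivAt_cauchyArray (hp0 : ∀ i, p i ≠ 0) (hp : ∀ i j, p i + p j ≠ 0)
    (hφ : ∀ i, HasDerivAt (fun t => φ t i) (φ s i / p i) s) (i j : Fin (2 * N)) :
    HasDerivAt (fun t => cauchyArray c p (φ t) i j)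
      ((vecMulVec (φ s) (φ s / p) - vecMulVec (φ s / p) (φ s)) i j) s := by
  have h := (((hφ i).const_mul ((p i - p j) / (p i + p j))).mul (hφ j)).const_add (c i j)
  refine h.congr_deriv ?_
  have := hp i j
  have := hp0 i
  have := hp0 j
  simp only [vecMulVec_apply, Matrix.sub_apply, Pi.div_apply]
  field_simp
  ring

theorem hasDerivAt_miwa (hp0 : ∀ i, p i ≠ 0) {a : ℂ} (ha : ∀ i, 1 - a * p i ≠ 0)
    (hφ : ∀ i, HasDerivAt (fun t => φ t i) (φ s i / p i) s) (i : Fin (2 * N)) :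
    HasDerivAt (fun t => miwa p a (φ t) i)
      ((φ s / p + a • (φ s + miwa p a (φ s))) i) s := by
  refine ((hφ i).mul_const ((1 + a * p i) / (1 - a * p i))).congr_deriv ?_
  have := hp0 i
  have := ha i
  have : 1 - p i * a ≠ 0 := by rw [mul_comm]; exact ha i
  simp only [miwa, Pi.add_apply, Pi.div_apply, Pi.smul_apply, smul_eq_mul]
  field_simp
  ring

/-- Near s, the three shifted pfaffians (the double one after multiplication by a - b) are F times
affine functions of the forms u = (φ, T_a φ), v = (φ, T_b φ), w = (T_a φ, T_b φ). Differentiating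
these relations leaves a polynomial identity. -/
theorem miwa_bilinear (hc : ∀ i j, c j i = -c i j) (hp0 : ∀ i, p i ≠ 0)
    (hp : ∀ i j, p i + p j ≠ 0) {a b : ℂ}
    (ha : ∀ i, 1 - a * p i ≠ 0) (hb : ∀ i, 1 - b * p i ≠ 0)
    (hφ : ∀ i, HasDerivAt (fun t => φ t i) (φ s i / p i) s)
    (hF0 : pfaffian (cauchyArray c p (φ s)) ≠ 0)
    {F Fa Fb Fab : ℝ → ℂ} {F' Fa' Fb' Fab' : ℂ}
    (eF : F = fun t => pfaffian (cauchyArray c p (φ t)))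
    (eFa : Fa = fun t => pfaffian (cauchyArray c p (miwa p a (φ t))))
    (eFb : Fb = fun t => pfaffian (cauchyArray c p (miwa p b (φ t))))
    (eFab : Fab = fun t => pfaffian (cauchyArray c p (miwa p a (miwa p b (φ t)))))
    (hF : HasDerivAt F F' s) (hFa : HasDerivAt Fa Fa' s)
    (hFb : HasDerivAt Fb Fb' s) (hFab : HasDerivAt Fab Fab' s) :
    (a - b) * (Fab' * F s - Fab s * F' - (a + b) * Fab s * F s) =
      (a + b) * (Fa' * Fb s - Fa s * Fb' - (a - b) * Fa s * Fb s) := by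
  have hT := cauchyArray_transpose hc (p := p)
  have hne : ∀ᶠ t in 𝓝 s, F t ≠ 0 :=
    hF.continuousAt.eventually_ne (by rw [eF]; exact hF0)
  have hdet : ∀ᶠ t in 𝓝 s, (cauchyArray c p (φ t)).det ≠ 0 := by
    filter_upwards [hne] with t ht
    rw [eF] at ht
    exact det_ne_zero_of_pfaffian_ne_zero (hT _) ht
  have hd := hdet.self_of_nhds
  have hA := hasDerivAt_cauchyArray (c := c) hp0 hp hφ
  have hX := hasDerivAt_miwa hp0 ha hφ
  have hY := hasDerivAt_miwa hp0 hb hφ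
  have hu := hasDerivAt_invForm hA hd hφ hX
  have hv := hasDerivAt_invForm hA hd hφ hY
  have hw := hasDerivAt_invForm hA hd hX hY
  have e1 : Fa =ᶠ[𝓝 s]
      fun t => (1 + invForm (cauchyArray c p (φ t)) (φ t) (miwa p a (φ t))) * F t := by
    filter_upwards [hdet] with t ht
    rw [eF, eFa]; exact pfaffian_miwa hc hp ha ht
  have e2 : Fb =ᶠ[𝓝 s]
      fun t => (1 + invForm (cauchyArray c p (φ t)) (φ t) (miwa p b (φ t))) * F t := by
    filter_upwards [hdet] with t ht
    rw [eF, eFb]; exact pfaffian_miwa hc hp hb ht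
  have e3 : (fun t => (a - b) * Fab t) =ᶠ[𝓝 s] fun t => (a - b - (a + b) *
      invForm (cauchyArray c p (φ t)) (miwa p a (φ t)) (miwa p b (φ t))) * F t := by
    filter_upwards [hdet] with t ht
    rw [eF, eFab]; exact pfaffian_miwa_miwa hc hp ha hb ht
  have d1 := hFa.unique (((hu.const_add 1).mul hF).congr_of_eventuallyEq e1)
  have d2 := hFb.unique (((hv.const_add 1).mul hF).congr_of_eventuallyEq e2)
  have d3 := (hFab.const_mul (a - b)).unique
    ((((hw.const_mul (a + b)).const_sub (a - b)).mul hF).congr_of_eventuallyEq e3)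
  have v1 := e1.self_of_nhds
  have v2 := e2.self_of_nhds
  have v3 := e3.self_of_nhds
  have hχ : (fun i => φ s i / p i) = φ s / p := rfl
  -- Because A' has rank two, the term xᵀA⁻¹A'A⁻¹y splits into products of forms.
  have hs : ∀ x y : Fin (2 * N) → ℂ, invForm (cauchyArray c p (φ s)) x
      ((vecMulVec (φ s) (φ s / p) - vecMulVec (φ s / p) (φ s)) *ᵥ
        ((cauchyArray c p (φ s))⁻¹ *ᵥ y)) =
      invForm (cauchyArray c p (φ s)) x (φ s) * invForm (cauchyArray c p (φ s)) (φ s / p) y -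
      invForm (cauchyArray c p (φ s)) x (φ s / p) * invForm (cauchyArray c p (φ s)) (φ s) y := by
    intro x y
    rw [← invForm_vecMulVec_mulVec, ← invForm_vecMulVec_mulVec, sub_mulVec, sub_eq_add_neg,
      invForm_add_right, ← neg_one_smul ℂ, invForm_smul_right]
    ring
  simp only [hχ, hs, invForm_add_left, invForm_add_right, invForm_smul_left,
    invForm_smul_right, invForm_self (hT (φ s))] at d1 d2 d3 v1 v2 v3
  rw [invForm_swap (hT _) (miwa p a (φ s)) (φ s),
    invForm_swap (hT _) (miwa p a (φ s)) (φ s / p)] at d3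
  generalize invForm (cauchyArray c p (φ s)) (φ s) (miwa p a (φ s)) = u at *
  generalize invForm (cauchyArray c p (φ s)) (φ s) (miwa p b (φ s)) = v at *
  generalize invForm (cauchyArray c p (φ s)) (miwa p a (φ s)) (miwa p b (φ s)) = w at *
  generalize invForm (cauchyArray c p (φ s)) (φ s) (φ s / p) = z at *
  generalize invForm (cauchyArray c p (φ s)) (φ s / p) (miwa p a (φ s)) = u₁ at *
  generalize invForm (cauchyArray c p (φ s)) (φ s / p) (miwa p b (φ s)) = v₁ at *
  rw [d1, d2, v1, v2]
  linear_combination F s * d3 - F' * v3 - (a + b) * F s * v3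

/-! ### The shifted determinants -/

/-- The array whose determinant is the product of a pfaffian and of its `a`-shift. -/
def mixedArray (c : Fin (2 * N) → Fin (2 * N) → ℂ) (p : Fin (2 * N) → ℂ) (a : ℂ)
    (φ : Fin (2 * N) → ℂ) : Matrix (Fin (2 * N)) (Fin (2 * N)) ℂ :=
  cauchyArray c p φ + vecMulVec (miwa p a φ) φ

/-- The vector `φ_i (1 + a p_i) / (1 - b p_i)`. -/
def mixedVec (p : Fin (2 * N) → ℂ) (a b : ℂ) (φ : Fin (2 * N) → ℂ) : Fin (2 * N) → ℂ :=
  fun i => φ i * ((1 + a * p i) / (1 - b * p i))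

theorem mixedArray_det_ne_zero (hc : ∀ i j, c j i = -c i j) (hp : ∀ i j, p i + p j ≠ 0) {a : ℂ}
    (ha : ∀ i, 1 - a * p i ≠ 0) {φ : Fin (2 * N) → ℂ} (hdet : (cauchyArray c p φ).det ≠ 0)
    (hg : pfaffian (cauchyArray c p (miwa p a φ)) ≠ 0) : (mixedArray c p a φ).det ≠ 0 := by
  rw [mixedArray, det_add_vecMulVec hdet]
  rw [pfaffian_miwa hc hp ha hdet] at hg
  exact mul_ne_zero hdet (left_ne_zero_of_mul hg)

/-- The determinant of M - κη_bᵀ is evaluated twice: as a rank-one update of M and as a rank-two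
update of A. -/
theorem hodograph_eq_mixed (hc : ∀ i j, c j i = -c i j) (hp : ∀ i j, p i + p j ≠ 0) {a b : ℂ}
    (ha : ∀ i, 1 - a * p i ≠ 0) (hb : ∀ i, 1 - b * p i ≠ 0) {φ : Fin (2 * N) → ℂ}
    (hdet : (cauchyArray c p φ).det ≠ 0)
    (hg : pfaffian (cauchyArray c p (miwa p a φ)) ≠ 0) :
    (a - b) * pfaffian (cauchyArray c p (miwa p a (miwa p b φ))) * pfaffian (cauchyArray c p φ) -
      (a + b) * pfaffian (cauchyArray c p (miwa p a φ)) *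
        pfaffian (cauchyArray c p (miwa p b φ)) =
      -2 * b * (1 - invForm (mixedArray c p a φ) (mixedVec p a b φ) (φ + miwa p a φ)) *
        (pfaffian (cauchyArray c p φ) * pfaffian (cauchyArray c p (miwa p a φ))) := by
  have hA := cauchyArray_transpose hc (p := p) φ
  have hM := mixedArray_det_ne_zero hc hp ha hdet hg
  have h1 := det_add_vecMulVec hM (-(φ + miwa p a φ)) (mixedVec p a b φ)
  have h2 := det_add_vecMulVec_add_vecMulVec hdet (miwa p a φ) φ (-(φ + miwa p a φ))
    (mixedVec p a b φ)
  have h3 := det_add_vecMulVec hdet (miwa p a φ) φ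
  rw [← mixedArray] at h2 h3
  -- This converts forms involving η_b into the forms that give the shifted pfaffians; multiplying
  -- by b avoids dividing by it.
  have hβ : b • mixedVec p a b φ = ((b - a) / 2) • φ + ((a + b) / 2) • miwa p b φ := by
    ext i
    have := hb i
    have : 1 - p i * b ≠ 0 := by rw [mul_comm]; exact hb i
    simp only [miwa, mixedVec, Pi.smul_apply, Pi.add_apply, smul_eq_mul]
    field_simp
    ring
  have h4 := congrArg (fun x => invForm (cauchyArray c p φ) x (miwa p a φ)) hβ
  have h5 := congrArg (fun x => invForm (cauchyArray c p φ) x φ) hβ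
  have hneg : ∀ (A : Matrix (Fin (2 * N)) (Fin (2 * N)) ℂ) (x y : Fin (2 * N) → ℂ),
      invForm A x (-y) = -invForm A x y := by
    intro A x y
    rw [← neg_one_smul ℂ, invForm_smul_right, neg_one_mul]
  simp only [hneg, invForm_add_left, invForm_add_right, invForm_smul_left,
    invForm_self hA] at h1 h2 h4 h5
  rw [invForm_swap hA (miwa p b φ) (miwa p a φ)] at h4
  rw [invForm_swap hA (miwa p b φ) φ] at h5
  rw [h3] at h1
  have h6 := h1.symm.trans h2
  rw [mul_assoc] at h6
  have h7 := mul_left_cancel₀ hdet h6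
  rw [pfaffian_miwa_miwa hc hp ha hb hdet, pfaffian_miwa hc hp ha hdet,
    pfaffian_miwa hc hp hb hdet, invForm_add_right]
  generalize invForm (cauchyArray c p φ) φ (miwa p a φ) = u at *
  generalize invForm (cauchyArray c p φ) φ (miwa p b φ) = v at *
  generalize invForm (cauchyArray c p φ) (miwa p a φ) (miwa p b φ) = w at *
  generalize invForm (cauchyArray c p φ) (mixedVec p a b φ) (miwa p a φ) = m₁ at *
  generalize invForm (cauchyArray c p φ) (mixedVec p a b φ) φ = m₂ at *
  generalize invForm (mixedArray c p a φ) (mixedVec p a b φ) (miwa p a φ) = m₃ at *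
  generalize invForm (mixedArray c p a φ) (mixedVec p a b φ) φ = m₄ at *
  generalize pfaffian (cauchyArray c p φ) = F at *
  linear_combination F ^ 2 * (2 * b * h7 - 2 * h4 - 2 * (1 + u) * h5)

end Flow

/-! ### The reduction and the second bilinear equation. -/

section Reduction

variable {N : ℕ} {c : Fin (2 * N) → Fin (2 * N) → ℂ} {p : Fin (2 * N) → ℂ}
  {φ : ℝ → Fin (2 * N) → ℂ} {s : ℝ}

theorem mixedArray_apply (hp : ∀ i j, p i + p j ≠ 0) {a : ℂ} (ha : ∀ i, 1 - a * p i ≠ 0)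
    (φ : Fin (2 * N) → ℂ) (i j : Fin (2 * N)) :
    mixedArray c p a φ i j =
      c i j + 2 * p i * (1 + a * p j) / ((p i + p j) * (1 - a * p i)) * φ i * φ j := by
  have := hp i j
  have := ha i
  have : 1 - p i * a ≠ 0 := by rw [mul_comm]; exact ha i
  simp only [mixedArray, cauchyArray, miwa, of_apply, Matrix.add_apply, vecMulVec_apply]
  field_simp
  ring

/-- A double shift of the mixed array is similar to its transpose under the reduction condition. -/
theorem det_mixedArray_add (hc : ∀ i j, c j i = -c i j) (hp0 : ∀ i, p i ≠ 0)
    (hp : ∀ i j, p i + p j ≠ 0) {a b : ℂ} (ha : ∀ i, 1 - a * p i ≠ 0)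
    (ha' : ∀ i, 1 + a * p i ≠ 0) (hb : ∀ i, 1 - b * p i ≠ 0) (hb' : ∀ i, 1 - -b * p i ≠ 0)
    (hK : ∀ i j, c i j * (p i * (1 - a ^ 2 * p i ^ 2) * (1 - b ^ 2 * p j ^ 2) +
      p j * (1 - a ^ 2 * p j ^ 2) * (1 - b ^ 2 * p i ^ 2)) = 0) (φ : Fin (2 * N) → ℂ) :
    (mixedArray c p a φ +
      vecMulVec ((φ + miwa p a φ) / p)
        (fun j => φ j * (p j * (1 + a * p j) / ((1 - b * p j) * (1 - -b * p j)))) +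
      vecMulVec (-(φ + miwa p a φ))
        ((1 / 2 : ℂ) • (mixedVec p a b φ + mixedVec p a (-b) φ))).det =
      (mixedArray c p a φ).det := by
  set M := mixedArray c p a φ +
      vecMulVec ((φ + miwa p a φ) / p)
        (fun j => φ j * (p j * (1 + a * p j) / ((1 - b * p j) * (1 - -b * p j)))) +
      vecMulVec (-(φ + miwa p a φ))
        ((1 / 2 : ℂ) • (mixedVec p a b φ + mixedVec p a (-b) φ)) with hMdef
  -- K_i = p_i(1-a²p_i²)/(1-b²p_i²): the reduction condition says K_i + K_j = 0 wherever c_ij ≠ 0,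
  -- so with c skew, diag(K) c = cᵀ diag(K).
  let K : Fin (2 * N) → ℂ := fun i =>
    p i * ((1 - a * p i) * (1 + a * p i)) / ((1 - b * p i) * (1 - -b * p i))
  have hK0 : ∀ i, K i ≠ 0 := fun i =>
    div_ne_zero (mul_ne_zero (hp0 i) (mul_ne_zero (ha i) (ha' i))) (mul_ne_zero (hb i) (hb' i))
  have hcK : ∀ i j, c i j * (K i + K j) = 0 := by
    intro i j
    have h := hK i j
    have h1 : K i + K j = (p i * (1 - a ^ 2 * p i ^ 2) * (1 - b ^ 2 * p j ^ 2) +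
      p j * (1 - a ^ 2 * p j ^ 2) * (1 - b ^ 2 * p i ^ 2)) /
        (((1 - b * p i) * (1 - -b * p i)) * ((1 - b * p j) * (1 - -b * p j))) := by
      simp only [K]
      rw [div_add_div _ _ (mul_ne_zero (hb i) (hb' i)) (mul_ne_zero (hb j) (hb' j))]
      congr 1
      ring
    rw [h1, ← mul_div_assoc, h, zero_div]
  have hM : diagonal K * M = (mixedArray c p a φ)ᵀ * diagonal K := by
    ext i j
    rw [diagonal_mul, mul_diagonal, transpose_apply, hMdef, Matrix.add_apply, Matrix.add_apply,
      mixedArray_apply hp ha, mixedArray_apply hp ha, hc i j]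
    -- For the Cauchy part, the two rank-one terms alter the kernel of M exactly so that
    -- multiplication by K_i gives the transposed kernel times K_j.
    have h1 := hp i j
    have h2 : p i * (2 * p i * (1 + a * p j) / ((p i + p j) * (1 - a * p i))) +
        (2 / (1 - a * p i)) * (p j * (1 + a * p j) / ((1 - b * p j) * (1 - -b * p j))) -
        p i * (2 / (1 - a * p i)) * ((1 + a * p j) / ((1 - b * p j) * (1 - -b * p j))) =
        2 * p j ^ 2 * (1 + a * p j) * ((1 - b * p i) * (1 - -b * p i)) /
          ((p i + p j) * (1 - a * p i) * ((1 - b * p j) * (1 - -b * p j))) := by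
      have e1 := ha i
      have e2 := hb j
      have e3 := hb' j
      generalize hx : 1 - a * p i = x at *
      generalize hy : 1 - b * p j = y at *
      generalize hz : 1 - -b * p j = z at *
      field_simp
      rw [← hy, ← hz]
      ring
    have h3 : (φ + miwa p a φ) i = φ i * (2 / (1 - a * p i)) := by
      have e1 := ha i
      have e2 : 1 - p i * a ≠ 0 := by rw [mul_comm]; exact ha i
      simp only [miwa, Pi.add_apply]
      field_simp
      ring
    have h4 : ((1 / 2 : ℂ) • (mixedVec p a b φ + mixedVec p a (-b) φ)) j =
        φ j * ((1 + a * p j) / ((1 - b * p j) * (1 - -b * p j))) := by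
      have e2 := hb j
      have e3 := hb' j
      simp only [mixedVec, Pi.add_apply, Pi.smul_apply, smul_eq_mul]
      generalize hy : 1 - b * p j = y at *
      generalize hz : 1 - -b * p j = z at *
      field_simp
      rw [← hy, ← hz]
      ring
    have h5 : K i * (2 * p j ^ 2 * (1 + a * p j) * ((1 - b * p i) * (1 - -b * p i)) /
          ((p i + p j) * (1 - a * p i) * ((1 - b * p j) * (1 - -b * p j)))) =
        p i * (2 * p j * (1 + a * p i) / ((p j + p i) * (1 - a * p j)) * K j) := by
      have := ha i
      have := ha j
      have := hb i
      have := hb' i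
      have := hb j
      have := hb' j
      simp only [K]
      rw [add_comm (p j)]
      generalize 1 - a * p i = x at *
      generalize 1 - a * p j = x' at *
      generalize 1 - b * p j = y at *
      generalize 1 - -b * p j = z at *
      generalize 1 - b * p i = y' at *
      generalize 1 - -b * p i = z' at *
      field_simp
    simp only [vecMulVec_apply, Pi.div_apply, Pi.neg_apply, h3, h4]
    rw [← h2] at h5
    have h6 := hcK i j
    have h0 := hp0 i
    apply mul_left_cancel₀ h0
    linear_combination p i * h6 + φ i * φ j * h5 +
      K i * φ i * φ j * (2 / (1 - a * p i)) *
        (p j * (1 + a * p j) / ((1 - b * p j) * (1 - -b * p j))) * (mul_inv_cancel₀ h0)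
  have h := congrArg Matrix.det hM
  rw [det_mul, det_mul, det_transpose, mul_comm] at h
  refine mul_right_cancel₀ ?_ h
  rw [det_diagonal]
  exact Finset.prod_ne_zero_iff.2 fun i _ => hK0 i

/-- Here too the flow cancels p_i + p_j; in the non-skew array M this leaves rank one. -/
theorem hasDerivAt_mixedArray (hp0 : ∀ i, p i ≠ 0) (hp : ∀ i j, p i + p j ≠ 0) {a : ℂ}
    (ha : ∀ i, 1 - a * p i ≠ 0)
    (hφ : ∀ i, HasDerivAt (fun t => φ t i) (φ s i / p i) s) (i j : Fin (2 * N)) :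
    HasDerivAt (fun t => mixedArray c p a (φ t) i j)
      (vecMulVec (φ s + miwa p a (φ s)) (mixedVec p a 0 (φ s) / p) i j) s := by
  simp only [mixedArray_apply hp ha]
  have h := (((hφ i).const_mul (2 * p i * (1 + a * p j) / ((p i + p j) * (1 - a * p i)))).mul
    (hφ j)).const_add (c i j)
  refine h.congr_deriv ?_
  have := hp i j
  have := hp0 i
  have := hp0 j
  have := ha i
  have e2 : 1 - p i * a ≠ 0 := by rw [mul_comm]; exact ha i
  simp only [vecMulVec_apply, Pi.add_apply, Pi.div_apply, miwa, mixedVec, zero_mul, sub_zero,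
    div_one]
  field_simp
  ring

theorem hasDerivAt_mixedVec (hp0 : ∀ i, p i ≠ 0) (a : ℂ) {b : ℂ} (hb : ∀ i, 1 - b * p i ≠ 0)
    (hφ : ∀ i, HasDerivAt (fun t => φ t i) (φ s i / p i) s) (i : Fin (2 * N)) :
    HasDerivAt (fun t => mixedVec p a b (φ t) i)
      ((mixedVec p a 0 (φ s) / p + b • mixedVec p a b (φ s)) i) s := by
  refine ((hφ i).mul_const ((1 + a * p i) / (1 - b * p i))).congr_deriv ?_
  have := hp0 i
  have := hb i
  have e2 : 1 - p i * b ≠ 0 := by rw [mul_comm]; exact hb i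
  simp only [mixedVec, Pi.add_apply, Pi.div_apply, Pi.smul_apply, smul_eq_mul, zero_mul, sub_zero,
    div_one]
  field_simp
  ring

/-- The ratio of the determinant shifted by `b` to the determinant of the mixed array. -/
def shiftRatio (c : Fin (2 * N) → Fin (2 * N) → ℂ) (p : Fin (2 * N) → ℂ) (a b : ℂ)
    (φ : Fin (2 * N) → ℂ) : ℂ :=
  1 - invForm (mixedArray c p a φ) (mixedVec p a b φ) (φ + miwa p a φ)

theorem hasDerivAt_shiftRatio (hp0 : ∀ i, p i ≠ 0) (hp : ∀ i j, p i + p j ≠ 0) {a b : ℂ}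
    (ha : ∀ i, 1 - a * p i ≠ 0) (hb : ∀ i, 1 - b * p i ≠ 0)
    (hφ : ∀ i, HasDerivAt (fun t => φ t i) (φ s i / p i) s)
    (hdet : (mixedArray c p a (φ s)).det ≠ 0) :
    HasDerivAt (fun t => shiftRatio c p a b (φ t))
      (-(invForm (mixedArray c p a (φ s)) (mixedVec p a 0 (φ s) / p) (φ s + miwa p a (φ s)) *
          shiftRatio c p a b (φ s) + b * (1 - shiftRatio c p a b (φ s)) +
        invForm (mixedArray c p a (φ s)) (mixedVec p a b (φ s))
          ((φ s + miwa p a (φ s)) / p))) s := by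
  have hκ : ∀ i, HasDerivAt (fun t => (φ t + miwa p a (φ t)) i)
      (((φ s + miwa p a (φ s)) / p) i) s := by
    intro i
    refine ((hφ i).add ((hφ i).mul_const ((1 + a * p i) / (1 - a * p i)))).congr_deriv ?_
    simp only [Pi.div_apply, Pi.add_apply, miwa]
    ring
  have h := (hasDerivAt_invForm (hasDerivAt_mixedArray (c := c) hp0 hp ha hφ) hdet
    (hasDerivAt_mixedVec hp0 a hb hφ) hκ).const_sub 1
  refine h.congr_deriv ?_
  simp only [invForm_vecMulVec_mulVec, shiftRatio]
  rw [invForm_add_left, invForm_smul_left]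
  ring

/-- The determinant equality from the reduction, divided by det M, is a quadratic relation among the
forms of η_{±b} with κ and κ/p. Partial fractions in ±b identify it with this Wronskian, since the
terms through M' cancel. -/
theorem shiftRatio_wronskian (hc : ∀ i j, c j i = -c i j) (hp0 : ∀ i, p i ≠ 0)
    (hp : ∀ i j, p i + p j ≠ 0) {a b : ℂ} (ha : ∀ i, 1 - a * p i ≠ 0)
    (ha' : ∀ i, 1 + a * p i ≠ 0) (hb : ∀ i, 1 - b * p i ≠ 0) (hb' : ∀ i, 1 - -b * p i ≠ 0)
    (hK : ∀ i j, c i j * (p i * (1 - a ^ 2 * p i ^ 2) * (1 - b ^ 2 * p j ^ 2) +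
      p j * (1 - a ^ 2 * p j ^ 2) * (1 - b ^ 2 * p i ^ 2)) = 0)
    (hφ : ∀ i, HasDerivAt (fun t => φ t i) (φ s i / p i) s)
    (hdet : (mixedArray c p a (φ s)).det ≠ 0) {q q' : ℂ}
    (hq : HasDerivAt (fun t => shiftRatio c p a b (φ t)) q s)
    (hq' : HasDerivAt (fun t => shiftRatio c p a (-b) (φ t)) q' s) :
    q' * shiftRatio c p a b (φ s) - shiftRatio c p a (-b) (φ s) * q +
      2 * b * shiftRatio c p a (-b) (φ s) * shiftRatio c p a b (φ s) = 2 * b := by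
  rw [hq.unique (hasDerivAt_shiftRatio hp0 hp ha hb hφ hdet),
    hq'.unique (hasDerivAt_shiftRatio hp0 hp ha hb' hφ hdet)]
  have h1 := det_mixedArray_add hc hp0 hp ha ha' hb hb' hK (φ s)
  rw [det_add_vecMulVec_add_vecMulVec hdet] at h1
  have h2 := mul_left_cancel₀ hdet (h1.trans (mul_one _).symm)
  have hη : b • (fun j => φ s j * (p j * (1 + a * p j) / ((1 - b * p j) * (1 - -b * p j)))) =
      (1 / 2 : ℂ) • (mixedVec p a b (φ s) + (-1 : ℂ) • mixedVec p a (-b) (φ s)) := by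
    ext j
    have e2 := hb j
    have e3 := hb' j
    simp only [mixedVec, Pi.add_apply, Pi.smul_apply, smul_eq_mul]
    generalize hy : 1 - b * p j = y at *
    generalize hz : 1 - -b * p j = z at *
    field_simp
    rw [← hy, ← hz]
    ring
  have h3 := congrArg (fun x => invForm (mixedArray c p a (φ s)) x (φ s + miwa p a (φ s))) hη
  have h4 := congrArg
    (fun x => invForm (mixedArray c p a (φ s)) x ((φ s + miwa p a (φ s)) / p)) hη
  have hneg : ∀ (A : Matrix (Fin (2 * N)) (Fin (2 * N)) ℂ) (x y : Fin (2 * N) → ℂ),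
      invForm A x (-y) = -invForm A x y := by
    intro A x y
    rw [← neg_one_smul ℂ, invForm_smul_right, neg_one_mul]
  unfold shiftRatio
  generalize (φ s + miwa p a (φ s)) / p = κ₁ at *
  generalize φ s + miwa p a (φ s) = κ at *
  simp only [hneg, invForm_add_left, invForm_smul_left] at h2 h3 h4
  generalize invForm (mixedArray c p a (φ s)) (mixedVec p a b (φ s)) κ = x at *
  generalize invForm (mixedArray c p a (φ s)) (mixedVec p a b (φ s)) κ₁ = y at *
  generalize invForm (mixedArray c p a (φ s)) (mixedVec p a (-b) (φ s)) κ = x' at *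
  generalize invForm (mixedArray c p a (φ s)) (mixedVec p a (-b) (φ s)) κ₁ = y' at *
  linear_combination 2 * b * h2 - 2 * (1 - (x + x') / 2) * h4 - (y + y') * h3

/-- The bilinear form of the reduction. -/
theorem hodograph_bilinear (hc : ∀ i j, c j i = -c i j) (hp0 : ∀ i, p i ≠ 0)
    (hp : ∀ i j, p i + p j ≠ 0) {a b : ℂ} (ha : ∀ i, 1 - a * p i ≠ 0)
    (ha' : ∀ i, 1 + a * p i ≠ 0) (hb : ∀ i, 1 - b * p i ≠ 0) (hb' : ∀ i, 1 - -b * p i ≠ 0)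
    (hK : ∀ i j, c i j * (p i * (1 - a ^ 2 * p i ^ 2) * (1 - b ^ 2 * p j ^ 2) +
      p j * (1 - a ^ 2 * p j ^ 2) * (1 - b ^ 2 * p i ^ 2)) = 0)
    (hφ : ∀ i, HasDerivAt (fun t => φ t i) (φ s i / p i) s)
    {F Fa E E₁ : ℝ → ℂ} {F' Fa' E' E₁' : ℂ}
    (eF : F = fun t => pfaffian (cauchyArray c p (φ t)))
    (eFa : Fa = fun t => pfaffian (cauchyArray c p (miwa p a (φ t))))
    (eE : E = fun t => (a - b) * pfaffian (cauchyArray c p (miwa p a (miwa p b (φ t)))) * F t -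
      (a + b) * Fa t * pfaffian (cauchyArray c p (miwa p b (φ t))))
    (eE₁ : E₁ = fun t => (a - b) * Fa t * pfaffian (cauchyArray c p (miwa p (-b) (φ t))) -
      (a + b) * pfaffian (cauchyArray c p (miwa p a (miwa p (-b) (φ t)))) * F t)
    (hF0 : F s ≠ 0) (hFa0 : Fa s ≠ 0)
    (hF : HasDerivAt F F' s) (hFa : HasDerivAt Fa Fa' s)
    (hE : HasDerivAt E E' s) (hE₁ : HasDerivAt E₁ E₁' s) :
    E₁' * E s - E₁ s * E' + 2 * b * E₁ s * E s = 8 * b ^ 3 * (F s * Fa s) ^ 2 := by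
  have hev : ∀ᶠ t in 𝓝 s, F t ≠ 0 ∧ Fa t ≠ 0 :=
    (hF.continuousAt.eventually_ne hF0).and (hFa.continuousAt.eventually_ne hFa0)
  have hdet : ∀ t, F t ≠ 0 → (cauchyArray c p (φ t)).det ≠ 0 := by
    intro t ht
    rw [eF] at ht
    exact det_ne_zero_of_pfaffian_ne_zero (cauchyArray_transpose hc _) ht
  have e1 : E =ᶠ[𝓝 s] fun t => -2 * b * shiftRatio c p a b (φ t) * (F t * Fa t) := by
    filter_upwards [hev] with t ht
    have h := hdet t ht.1
    have h' := ht.2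
    rw [eFa] at h'
    rw [eE, eF, eFa]
    exact hodograph_eq_mixed hc hp ha hb h h'
  have e2 : E₁ =ᶠ[𝓝 s] fun t => -2 * b * shiftRatio c p a (-b) (φ t) * (F t * Fa t) := by
    filter_upwards [hev] with t ht
    have h := hdet t ht.1
    have h' := ht.2
    rw [eFa] at h'
    rw [eE₁, eF, eFa]
    have := hodograph_eq_mixed hc hp ha hb' h h'
    rw [← shiftRatio] at this
    linear_combination -this
  have hm : (mixedArray c p a (φ s)).det ≠ 0 := by
    rw [eFa] at hFa0
    exact mixedArray_det_ne_zero hc hp ha (hdet s hF0) hFa0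
  have hq := hasDerivAt_shiftRatio hp0 hp ha hb hφ hm
  have hq' := hasDerivAt_shiftRatio hp0 hp ha hb' hφ hm
  have hw := shiftRatio_wronskian hc hp0 hp ha ha' hb hb' hK hφ hm hq hq'
  have d1 := hE.unique (((hq.const_mul (-2 * b)).mul (hF.mul hFa)).congr_of_eventuallyEq e1)
  have d2 := hE₁.unique (((hq'.const_mul (-2 * b)).mul (hF.mul hFa)).congr_of_eventuallyEq e2)
  rw [d1, d2, e1.self_of_nhds, e2.self_of_nhds]
  simp only [Pi.mul_apply]
  linear_combination 4 * b ^ 2 * (F s * Fa s) ^ 2 * hw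

end Reduction

/-! ### From bilinear equations to the semi-discrete system -/

section System

variable {a b : ℂ} {f g : ℤ → ℝ → ℂ} {l : ℤ} {s : ℝ}

/-- The combination `(a - b) g_{l+1} f_l - (a + b) g_l f_{l+1}`. -/
def hodographNum (a b : ℂ) (f g : ℤ → ℝ → ℂ) (l : ℤ) (s : ℝ) : ℂ :=
  (a - b) * g (l + 1) s * f l s - (a + b) * g l s * f (l + 1) s

theorem hodographNum_ne_zero (hδ : deltaOf a b f g l s ≠ 0) : hodographNum a b f g l s ≠ 0 := by
  intro h0
  apply hδ
  simp only [deltaOf]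
  rw [← hodographNum, h0]
  simp

theorem RegularAt.eventually (hf : ∀ l, Differentiable ℝ (f l)) (hg : ∀ l, Differentiable ℝ (g l))
    (h : RegularAt a b f g l s) : ∀ᶠ t in 𝓝 s, RegularAt a b f g l t := by
  have cf : ∀ l, Continuous (f l) := fun l => (hf l).continuous
  have cg : ∀ l, Continuous (g l) := fun l => (hg l).continuous
  obtain ⟨h1, h2, h3, h4, h5⟩ := h
  have cd : Continuous (hodographDen a b f g l) :=
    ((continuous_const.mul (cg _)).mul (cf _)).add ((continuous_const.mul (cg _)).mul (cf _))
  filter_upwards [(cf l).continuousAt.eventually_ne h1, (cg l).continuousAt.eventually_ne h2,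
    (cf (l + 1)).continuousAt.eventually_ne h3, (cg (l + 1)).continuousAt.eventually_ne h4,
    cd.continuousAt.eventually_ne h5] with t t1 t2 t3 t4 t5
  exact ⟨t1, t2, t3, t4, t5⟩

theorem uOf_eq (hf : ∀ l, Differentiable ℝ (f l)) (hg : ∀ l, Differentiable ℝ (g l))
    (h1 : f l s ≠ 0) (h2 : g l s ≠ 0) :
    uOf f g l s = logDeriv (g l) s - logDeriv (f l) s :=
  logDeriv_div s h2 h1 (hg l s) (hf l s)

theorem hasDerivAt_mul_of_ne_zero (c : ℂ) {v w : ℝ → ℂ} (hv : Differentiable ℝ v)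
    (hw : Differentiable ℝ w) (h1 : v s ≠ 0) (h2 : w s ≠ 0) :
    HasDerivAt (fun t => c * v t * w t) (c * v s * w s * (logDeriv v s + logDeriv w s)) s := by
  refine (((hv s).hasDerivAt.const_mul c).mul (hw s).hasDerivAt).congr_deriv ?_
  simp only [logDeriv_apply]
  field_simp

theorem hasDerivAt_hodographNum (hf : ∀ l, Differentiable ℝ (f l))
    (hg : ∀ l, Differentiable ℝ (g l)) (h : RegularAt a b f g l s) :
    HasDerivAt (hodographNum a b f g l)
      ((a - b) * g (l + 1) s * f l s * (logDeriv (g (l + 1)) s + logDeriv (f l) s) -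
        (a + b) * g l s * f (l + 1) s * (logDeriv (g l) s + logDeriv (f (l + 1)) s)) s := by
  obtain ⟨h1, h2, h3, h4, -⟩ := h
  exact (hasDerivAt_mul_of_ne_zero _ (hg _) (hf _) h4 h1).sub
    (hasDerivAt_mul_of_ne_zero _ (hg _) (hf _) h2 h3)

theorem hasDerivAt_hodographDen (hf : ∀ l, Differentiable ℝ (f l))
    (hg : ∀ l, Differentiable ℝ (g l)) (h : RegularAt a b f g l s) :
    HasDerivAt (hodographDen a b f g l)
      ((a - b) * g (l + 1) s * f l s * (logDeriv (g (l + 1)) s + logDeriv (f l) s) +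
        (a + b) * g l s * f (l + 1) s * (logDeriv (g l) s + logDeriv (f (l + 1)) s)) s := by
  obtain ⟨h1, h2, h3, h4, -⟩ := h
  exact (hasDerivAt_mul_of_ne_zero _ (hg _) (hf _) h4 h1).add
    (hasDerivAt_mul_of_ne_zero _ (hg _) (hf _) h2 h3)

/-- With δ = 2(P-Q)/(P+Q), one has 1 - δ²/4 = 4PQ/(P+Q)², while the logarithmic derivative of P/Q is
u_{l+1} - u_l. -/
theorem meshEquation (hf : ∀ l, Differentiable ℝ (f l)) (hg : ∀ l, Differentiable ℝ (g l))
    (h : RegularAt a b f g l s) : MeshEquation (uOf f g) (deltaOf a b f g) l s := by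
  have hd := (((hasDerivAt_hodographNum hf hg h).div (hasDerivAt_hodographDen hf hg h)
    h.2.2.2.2).const_mul 2)
  refine hd.congr_deriv ?_
  rw [uOf_eq hf hg h.1 h.2.1, uOf_eq hf hg h.2.2.1 h.2.2.2.1]
  have h5 := h.2.2.2.2
  simp only [deltaOf, hodographNum, hodographDen] at h5 ⊢
  generalize (a - b) * g (l + 1) s * f l s = P at *
  generalize (a + b) * g l s * f (l + 1) s = Q at *
  field_simp
  ring

/-- The bilinear equation coupling the two shifts, in terms of `δ_l`. -/
theorem deltaOf_mul_avg (h : RegularAt a b f g l s)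
    (hbil : (a - b) * (deriv (g (l + 1)) s * f l s - g (l + 1) s * deriv (f l) s -
        (a + b) * g (l + 1) s * f l s) =
      (a + b) * (deriv (g l) s * f (l + 1) s - g l s * deriv (f (l + 1)) s -
        (a - b) * g l s * f (l + 1) s)) :
    deltaOf a b f g l s * ((logDeriv (g (l + 1)) s - logDeriv (f (l + 1)) s +
        (logDeriv (g l) s - logDeriv (f l) s)) / 2 - a) =
      2 * b - (logDeriv (g (l + 1)) s + logDeriv (f (l + 1)) s -
        (logDeriv (g l) s + logDeriv (f l) s)) := by
  obtain ⟨h1, h2, h3, h4, h5⟩ := h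
  have e : ∀ {v : ℝ → ℂ}, v s ≠ 0 → deriv v s = logDeriv v s * v s := by
    intro v hv
    rw [logDeriv_apply, div_mul_cancel₀ _ hv]
  rw [e h1, e h2, e h3, e h4] at hbil
  simp only [deltaOf, hodographDen] at h5 ⊢
  rw [mul_div_assoc', div_mul_eq_mul_div, div_eq_iff h5]
  linear_combination 2 * hbil

/-- E_l = P - Q, and (P+Q)/(P-Q) = 2/δ_l: the logarithmic derivative of E_l is the mean of those of
P and Q plus (u_{l+1} - u_l)/δ_l. -/
theorem logDeriv_hodographNum_left (hf : ∀ l, Differentiable ℝ (f l))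
    (hg : ∀ l, Differentiable ℝ (g l)) (h : RegularAt a b f g l s)
    (hδ : deltaOf a b f g l s ≠ 0) :
    logDeriv (hodographNum a b f g l) s - (logDeriv (g l) s + logDeriv (f l) s) =
      (uOf f g (l + 1) s - uOf f g l s) / deltaOf a b f g l s +
      (logDeriv (g (l + 1)) s + logDeriv (f (l + 1)) s -
        (logDeriv (g l) s + logDeriv (f l) s)) / 2 := by
  rw [logDeriv_apply, (hasDerivAt_hodographNum hf hg h).deriv, uOf_eq hf hg h.1 h.2.1,
    uOf_eq hf hg h.2.2.1 h.2.2.2.1]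
  have h5 := h.2.2.2.2
  have h6 := hodographNum_ne_zero hδ
  simp only [deltaOf, hodographNum, hodographDen] at h5 h6 ⊢
  generalize (a - b) * g (l + 1) s * f l s = P at *
  generalize (a + b) * g l s * f (l + 1) s = Q at *
  field_simp
  ring

theorem logDeriv_hodographNum_right (hf : ∀ l, Differentiable ℝ (f l))
    (hg : ∀ l, Differentiable ℝ (g l)) (h : RegularAt a b f g l s)
    (hδ : deltaOf a b f g l s ≠ 0) :
    logDeriv (hodographNum a b f g l) s - (logDeriv (g (l + 1)) s + logDeriv (f (l + 1)) s) =
      (uOf f g (l + 1) s - uOf f g l s) / deltaOf a b f g l s -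
      (logDeriv (g (l + 1)) s + logDeriv (f (l + 1)) s -
        (logDeriv (g l) s + logDeriv (f l) s)) / 2 := by
  linear_combination logDeriv_hodographNum_left hf hg h hδ

/-- Under the bilinear equations, `m_l` is a quotient of products of tau functions. -/
theorem momentum_eq (hf : ∀ l, Differentiable ℝ (f l))
    (hg : ∀ l, Differentiable ℝ (g l))
    (hbil : ∀ l s, RegularAt a b f g l s →
      (a - b) * (deriv (g (l + 1)) s * f l s - g (l + 1) s * deriv (f l) s -
        (a + b) * g (l + 1) s * f l s) =
      (a + b) * (deriv (g l) s * f (l + 1) s - g l s * deriv (f (l + 1)) s -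
        (a - b) * g l s * f (l + 1) s))
    (hred : ∀ l s, f l s ≠ 0 → g l s ≠ 0 →
      deriv (hodographNum a b f g (l - 1)) s * hodographNum a b f g l s -
        hodographNum a b f g (l - 1) s * deriv (hodographNum a b f g l) s +
        2 * b * hodographNum a b f g (l - 1) s * hodographNum a b f g l s =
      8 * b ^ 3 * (f l s * g l s) ^ 2)
    (h₁ : RegularAt a b f g (l - 1) s) (h : RegularAt a b f g l s)
    (hδ₁ : deltaOf a b f g (l - 1) s ≠ 0) (hδ : deltaOf a b f g l s ≠ 0)
    (hM : deltaOf a b f g l s + deltaOf a b f g (l - 1) s ≠ 0) :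
    momentum a (fun j => uOf f g j s) (fun j => deltaOf a b f g j s) l =
      16 * b ^ 3 * (f l s * g l s) ^ 2 /
        (hodographNum a b f g (l - 1) s * hodographNum a b f g l s *
          (deltaOf a b f g l s + deltaOf a b f g (l - 1) s)) := by
  have hA := logDeriv_hodographNum_left hf hg h hδ
  have hB := logDeriv_hodographNum_right hf hg h₁ hδ₁
  have hI := deltaOf_mul_avg h (hbil l s h)
  have hI₁ := deltaOf_mul_avg h₁ (hbil (l - 1) s h₁)
  have hR := hred l s h.1 h.2.1
  have hE := hodographNum_ne_zero hδ
  have hE₁ := hodographNum_ne_zero hδ₁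
  have e : ∀ {v : ℝ → ℂ}, v s ≠ 0 → deriv v s = logDeriv v s * v s := by
    intro v hv
    rw [logDeriv_apply, div_mul_cancel₀ _ hv]
  rw [e hE, e hE₁] at hR
  have u1 := uOf_eq hf hg h.1 h.2.1
  have u2 := uOf_eq hf hg h.2.2.1 h.2.2.2.1
  have u0 := uOf_eq hf hg h₁.1 h₁.2.1
  rw [sub_add_cancel] at hB hI₁
  rw [← u1, ← u2] at hI
  rw [← u1, ← u0] at hI₁
  -- After division by E_{l-1}E_l, the left side of the second bilinear equation is Mδ_l · m_l.
  have hR' : logDeriv (hodographNum a b f g (l - 1)) s - logDeriv (hodographNum a b f g l) s +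
      2 * b = 8 * b ^ 3 * (f l s * g l s) ^ 2 /
        (hodographNum a b f g (l - 1) s * hodographNum a b f g l s) := by
    rw [eq_div_iff (mul_ne_zero hE₁ hE)]
    linear_combination hR
  have hR2 : 16 * b ^ 3 * (f l s * g l s) ^ 2 /
        (hodographNum a b f g (l - 1) s * hodographNum a b f g l s *
          (deltaOf a b f g l s + deltaOf a b f g (l - 1) s)) =
      2 * (logDeriv (hodographNum a b f g (l - 1)) s - logDeriv (hodographNum a b f g l) s +
        2 * b) / (deltaOf a b f g l s + deltaOf a b f g (l - 1) s) := by
    rw [hR', ← div_div]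
    ring
  rw [hR2]
  simp only [momentum, diffOp, avgOp, sub_add_cancel, add_sub_cancel_right]
  rw [eq_div_iff hM]
  have hM2 : (deltaOf a b f g l s + deltaOf a b f g (l - 1) s) / 2 ≠ 0 :=
    div_ne_zero hM two_ne_zero
  rw [← add_div, div_sub' hM2, div_mul_eq_mul_div, div_eq_iff hM2]
  linear_combination (deltaOf a b f g l s + deltaOf a b f g (l - 1) s) *
    (hA - hB + (hI + hI₁) / 2)

theorem momentumEquation (hf : ∀ l, Differentiable ℝ (f l))
    (hg : ∀ l, Differentiable ℝ (g l)) (hb : b ≠ 0)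
    (hbil : ∀ l s, RegularAt a b f g l s →
      (a - b) * (deriv (g (l + 1)) s * f l s - g (l + 1) s * deriv (f l) s -
        (a + b) * g (l + 1) s * f l s) =
      (a + b) * (deriv (g l) s * f (l + 1) s - g l s * deriv (f (l + 1)) s -
        (a - b) * g l s * f (l + 1) s))
    (hred : ∀ l s, f l s ≠ 0 → g l s ≠ 0 →
      deriv (hodographNum a b f g (l - 1)) s * hodographNum a b f g l s -
        hodographNum a b f g (l - 1) s * deriv (hodographNum a b f g l) s +
        2 * b * hodographNum a b f g (l - 1) s * hodographNum a b f g l s =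
      8 * b ^ 3 * (f l s * g l s) ^ 2)
    (h₁ : RegularAt a b f g (l - 1) s) (h : RegularAt a b f g l s)
    (hδ₁ : deltaOf a b f g (l - 1) s ≠ 0) (hδ : deltaOf a b f g l s ≠ 0)
    (hM : deltaOf a b f g l s + deltaOf a b f g (l - 1) s ≠ 0) :
    MomentumEquation a (uOf f g) (deltaOf a b f g) l s := by
  have hm := meshEquation hf hg h
  have hm₁ := meshEquation hf hg h₁
  have hev : (fun t => momentum a (fun j => uOf f g j t) (fun j => deltaOf a b f g j t) l)
      =ᶠ[𝓝 s] fun t => 16 * b ^ 3 * (f l t * g l t) ^ 2 /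
        (hodographNum a b f g (l - 1) t * hodographNum a b f g l t *
          (deltaOf a b f g l t + deltaOf a b f g (l - 1) t)) := by
    filter_upwards [h.eventually hf hg, h₁.eventually hf hg,
      hm.continuousAt.eventually_ne hδ, hm₁.continuousAt.eventually_ne hδ₁,
      (hm.continuousAt.add hm₁.continuousAt).eventually_ne hM] with t t1 t2 t3 t4 t5
    exact momentum_eq hf hg hbil hred t2 t1 t4 t3 t5
  have hE := hodographNum_ne_zero hδ
  have hE₁ := hodographNum_ne_zero hδ₁
  have hfg : f l s * g l s ≠ 0 := mul_ne_zero h.1 h.2.1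
  have hd : HasDerivAt (fun t => 16 * b ^ 3 * (f l t * g l t) ^ 2 /
        (hodographNum a b f g (l - 1) t * hodographNum a b f g l t *
          (deltaOf a b f g l t + deltaOf a b f g (l - 1) t)))
      (16 * b ^ 3 * (f l s * g l s) ^ 2 /
        (hodographNum a b f g (l - 1) s * hodographNum a b f g l s *
          (deltaOf a b f g l s + deltaOf a b f g (l - 1) s)) *
        (2 * (logDeriv (g l) s + logDeriv (f l) s) - logDeriv (hodographNum a b f g l) s -
          logDeriv (hodographNum a b f g (l - 1)) s -
          ((1 - deltaOf a b f g l s ^ 2 / 4) * (uOf f g (l + 1) s - uOf f g l s) +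
            (1 - deltaOf a b f g (l - 1) s ^ 2 / 4) * (uOf f g l s - uOf f g (l - 1) s)) /
            (deltaOf a b f g l s + deltaOf a b f g (l - 1) s))) s := by
    have d1 := (((hf l s).hasDerivAt.mul (hg l s).hasDerivAt).pow 2).const_mul (16 * b ^ 3)
    have d2 := ((hasDerivAt_hodographNum hf hg h₁).differentiableAt.hasDerivAt.mul
      (hasDerivAt_hodographNum hf hg h).differentiableAt.hasDerivAt).mul (hm.add hm₁)
    have hden : hodographNum a b f g (l - 1) s * hodographNum a b f g l s *
        (deltaOf a b f g l s + deltaOf a b f g (l - 1) s) ≠ 0 :=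
      mul_ne_zero (mul_ne_zero hE₁ hE) hM
    refine (d1.div d2 hden).congr_deriv ?_
    have h1 := h.1
    have h2 := h.2.1
    simp only [logDeriv_apply, Pi.mul_apply, Pi.add_apply, Pi.pow_apply, sub_add_cancel,
      Nat.cast_ofNat, Nat.add_one_sub_one, pow_one]
    generalize uOf f g l s = u₁
    generalize uOf f g (l + 1) s = u₂
    generalize uOf f g (l - 1) s = u₀
    generalize deltaOf a b f g l s = δ at *
    generalize deltaOf a b f g (l - 1) s = δ₁ at *
    generalize hodographNum a b f g l s = E at *
    generalize hodographNum a b f g (l - 1) s = E₁ at *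
    field_simp
    ring
  have hval : momentum a (fun j => uOf f g j s) (fun j => deltaOf a b f g j s) l = _ :=
    hev.self_of_nhds
  refine ⟨(hd.congr_of_eventuallyEq hev).differentiableAt, ?_, ?_⟩
  · refine hval.trans_ne ?_
    exact div_ne_zero (mul_ne_zero (mul_ne_zero (by norm_num) (pow_ne_zero _ hb))
      (pow_ne_zero _ hfg)) (mul_ne_zero (mul_ne_zero hE₁ hE) hM)
  · have hne : 16 * b ^ 3 * (f l s * g l s) ^ 2 /
        (hodographNum a b f g (l - 1) s * hodographNum a b f g l s *
          (deltaOf a b f g l s + deltaOf a b f g (l - 1) s)) ≠ 0 :=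
      div_ne_zero (mul_ne_zero (mul_ne_zero (by norm_num) (pow_ne_zero _ hb))
        (pow_ne_zero _ hfg)) (mul_ne_zero (mul_ne_zero hE₁ hE) hM)
    rw [logDeriv_apply, (hd.congr_of_eventuallyEq hev).deriv, hval, mul_div_cancel_left₀ _ hne]
    have hA := logDeriv_hodographNum_left hf hg h hδ
    have hB := logDeriv_hodographNum_right hf hg h₁ hδ₁
    have hI := deltaOf_mul_avg h (hbil l s h)
    have hI₁ := deltaOf_mul_avg h₁ (hbil (l - 1) s h₁)
    have u1 := uOf_eq hf hg h.1 h.2.1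
    have u2 := uOf_eq hf hg h.2.2.1 h.2.2.2.1
    have u0 := uOf_eq hf hg h₁.1 h₁.2.1
    rw [sub_add_cancel] at hB hI₁
    rw [← u1, ← u2] at hI
    rw [← u1, ← u0] at hI₁
    simp only [momentumRHS, diffOp, avgOp, sub_add_cancel, add_sub_cancel_right]
    rw [mul_div_cancel₀ _ hδ, mul_div_cancel₀ _ hδ₁]
    -- The difference of the first bilinear equation at l and l-1 cancels 2b and supplies the term
    -- δ_l(Mu_{l+1}-a) - δ_{l-1}(Mu_l-a).
    have hI2 := congrArg₂ (· - ·) hI hI₁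
    rw [hI2]
    have hfrac : ((1 - deltaOf a b f g l s ^ 2 / 4) * (uOf f g (l + 1) s - uOf f g l s) +
        (1 - deltaOf a b f g (l - 1) s ^ 2 / 4) * (uOf f g l s - uOf f g (l - 1) s)) /
        (deltaOf a b f g l s + deltaOf a b f g (l - 1) s) =
        (uOf f g (l + 1) s - uOf f g l s + (uOf f g l s - uOf f g (l - 1) s)) / 2 /
          ((deltaOf a b f g l s + deltaOf a b f g (l - 1) s) / 2) -
        (deltaOf a b f g l s ^ 2 * (uOf f g (l + 1) s - uOf f g l s) +
          deltaOf a b f g (l - 1) s ^ 2 * (uOf f g l s - uOf f g (l - 1) s)) / 2 /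
          (4 * ((deltaOf a b f g l s + deltaOf a b f g (l - 1) s) / 2)) := by
      field_simp
      ring
    rw [hfrac]
    linear_combination -hA - hB

end System

/-! ### The soliton tau functions -/

section Soliton

variable {N : ℕ} {a b : ℂ} {p ξ C : Fin (2 * N) → ℂ}

theorem tau_eq (k l : ℤ) (s : ℝ) : tau a b p ξ C k l s =
    pfaffian (cauchyArray (cCoeff a b p C) p fun i => phi a b p ξ i 0 k l s) := rfl

theorem phi_shift_k (l : ℤ) (s : ℝ) : (fun i => phi a b p ξ i 0 1 l s) =
    miwa p a fun i => phi a b p ξ i 0 0 l s := by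
  funext i
  simp only [phi, miwa, zpow_one, zpow_zero]
  ring

theorem phi_shift_l (hb : ∀ i, 1 - b * p i ≠ 0) (hb' : ∀ i, 1 + b * p i ≠ 0) (k l : ℤ) (s : ℝ) :
    (fun i => phi a b p ξ i 0 k (l + 1) s) = miwa p b fun i => phi a b p ξ i 0 k l s := by
  funext i
  simp only [phi, miwa]
  rw [zpow_add_one₀ (div_ne_zero (hb' i) (hb i))]
  ring

theorem phi_shift_neg_l (hb : ∀ i, 1 - b * p i ≠ 0) (hb' : ∀ i, 1 + b * p i ≠ 0) (k l : ℤ)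
    (s : ℝ) :
    (fun i => phi a b p ξ i 0 k (l - 1) s) = miwa p (-b) fun i => phi a b p ξ i 0 k l s := by
  funext i
  simp only [phi, miwa]
  rw [zpow_sub_one₀ (div_ne_zero (hb' i) (hb i)), inv_div, neg_mul, sub_neg_eq_add,
    ← sub_eq_add_neg]
  ring

theorem hasDerivAt_phi (k l : ℤ) (s : ℝ) (i : Fin (2 * N)) :
    HasDerivAt (fun t => phi a b p ξ i 0 k l t) (phi a b p ξ i 0 k l s / p i) s := by
  have h := ((((Complex.ofRealCLM.hasDerivAt (x := s)).const_mul (p i)⁻¹).add_const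
    (ξ i)).cexp).const_mul
    (p i ^ (0 : ℤ) * ((1 + a * p i) / (1 - a * p i)) ^ k * ((1 + b * p i) / (1 - b * p i)) ^ l)
  refine h.congr_deriv ?_
  simp only [phi, Complex.ofRealCLM_apply, Complex.ofReal_one]
  ring

theorem differentiable_tau (k l : ℤ) : Differentiable ℝ (tau a b p ξ C k l) := by
  have he : ∀ i j, Differentiable ℝ fun s => entry a b p ξ C k l s i j := fun i j s =>
    (((hasDerivAt_phi k l s i).differentiableAt.const_mul _).mul
      (hasDerivAt_phi k l s j).differentiableAt).const_add _
  unfold tau pfaffian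
  refine Differentiable.const_mul (Differentiable.fun_sum fun σ _ => Differentiable.const_mul ?_ _) _
  exact Differentiable.fun_finsetProd fun m _ => he _ _

/-- Over a common denominator, c_ij + c_ji is a multiple of the reduction expression. -/
theorem cCoeff_skew (ha : ∀ i, 1 - a * p i ≠ 0) (hb' : ∀ i, 1 + b * p i ≠ 0)
    (hC : ∀ i, C (Fin.rev i) = C i)
    (hred : ∀ i, p i * (1 - a ^ 2 * p i ^ 2) * (1 - b ^ 2 * p (Fin.rev i) ^ 2) +
      p (Fin.rev i) * (1 - a ^ 2 * p (Fin.rev i) ^ 2) * (1 - b ^ 2 * p i ^ 2) = 0)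
    (i j : Fin (2 * N)) : cCoeff a b p C j i = -cCoeff a b p C i j := by
  by_cases hij : j = Fin.rev i
  · subst hij
    have h := hred i
    have h1 := ha i
    have h2 := ha (Fin.rev i)
    have h3 := hb' i
    have h4 := hb' (Fin.rev i)
    simp only [cCoeff, Fin.rev_rev, if_true, hC]
    rw [eq_neg_iff_add_eq_zero]
    generalize p (Fin.rev i) = q at *
    have e : 2 * q * C i * ((1 + a * q) / (1 - a * p i)) * ((1 - b * p i) / (1 + b * q)) +
        2 * p i * C i * ((1 + a * p i) / (1 - a * q)) * ((1 - b * q) / (1 + b * p i)) =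
        2 * C i * (p i * (1 - a ^ 2 * p i ^ 2) * (1 - b ^ 2 * q ^ 2) +
          q * (1 - a ^ 2 * q ^ 2) * (1 - b ^ 2 * p i ^ 2)) /
          ((1 - a * p i) * (1 - a * q) * ((1 + b * p i) * (1 + b * q))) := by
      rw [eq_div_iff (by positivity)]
      generalize hx : 1 - a * p i = x at *
      generalize hy : 1 - a * q = y at *
      generalize hz : 1 + b * p i = z at *
      generalize hw : 1 + b * q = w at *
      field_simp
      rw [← hx, ← hy, ← hz, ← hw]
      ring
    rw [e, h, mul_zero, zero_div]
  · have hji : i ≠ Fin.rev j := fun h => hij (by rw [h, Fin.rev_rev])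
    simp [cCoeff, hij, hji]

/-- If 1 + a p_i = 0, both summands in row i of the array at k = 1 vanish. This recovers a condition
needed for K_i ≠ 0 from g_l ≠ 0. -/
theorem one_add_ne_zero_of_tau_ne_zero (hc : ∀ i j, cCoeff a b p C j i = -cCoeff a b p C i j)
    {l : ℤ} {s : ℝ} (h : tau a b p ξ C 1 l s ≠ 0) (i : Fin (2 * N)) : 1 + a * p i ≠ 0 := by
  intro h0
  rw [tau_eq] at h
  refine det_ne_zero_of_pfaffian_ne_zero (cauchyArray_transpose hc _) h
    (Matrix.det_eq_zero_of_row_eq_zero i fun j => ?_)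
  simp [cauchyArray, cCoeff, phi, h0]

/-- The soliton tau functions solve the semi-discrete Degasperis-Procesi system. -/
theorem soliton_solution (hp : ∀ i, p i ≠ 0) (hpp : ∀ i j, i ≠ j → p i + p j ≠ 0)
    (ha : ∀ i, 1 - a * p i ≠ 0) (hb : ∀ i, 1 - b * p i ≠ 0) (hb' : ∀ i, 1 + b * p i ≠ 0)
    (hC : ∀ i, C (Fin.rev i) = C i)
    (hred : ∀ i, p i * (1 - a ^ 2 * p i ^ 2) * (1 - b ^ 2 * p (Fin.rev i) ^ 2) +
      p (Fin.rev i) * (1 - a ^ 2 * p (Fin.rev i) ^ 2) * (1 - b ^ 2 * p i ^ 2) = 0)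
    {f g : ℤ → ℝ → ℂ} (hf : f = fTau a b p ξ C) (hg : g = gTau a b p ξ C) :
    (∀ (l : ℤ) (s : ℝ), RegularAt a b f g l s →
      MeshEquation (uOf f g) (deltaOf a b f g) l s) ∧
    (∀ (l : ℤ) (s : ℝ), RegularAt a b f g (l - 1) s → RegularAt a b f g l s →
      deltaOf a b f g (l - 1) s ≠ 0 → deltaOf a b f g l s ≠ 0 →
      deltaOf a b f g l s + deltaOf a b f g (l - 1) s ≠ 0 →
      MomentumEquation a (uOf f g) (deltaOf a b f g) l s) := by
  have df : ∀ l, Differentiable ℝ (f l) := by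
    rw [hf]; exact fun l => differentiable_tau 0 l
  have dg : ∀ l, Differentiable ℝ (g l) := by
    rw [hg]; exact fun l => differentiable_tau 1 l
  refine ⟨fun l s h => meshEquation df dg h, fun l s h₁ h hδ₁ hδ hM => ?_⟩
  have hp2 : ∀ i j, p i + p j ≠ 0 := by
    intro i j
    by_cases hij : i = j
    · rw [hij, ← two_mul]; exact mul_ne_zero two_ne_zero (hp j)
    · exact hpp i j hij
  have hb2 : ∀ i, 1 - -b * p i ≠ 0 := by
    intro i; rw [neg_mul, sub_neg_eq_add]; exact hb' i
  have hc := cCoeff_skew ha hb' hC hred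
  have hK : ∀ i j, cCoeff a b p C i j * (p i * (1 - a ^ 2 * p i ^ 2) * (1 - b ^ 2 * p j ^ 2) +
      p j * (1 - a ^ 2 * p j ^ 2) * (1 - b ^ 2 * p i ^ 2)) = 0 := by
    intro i j
    by_cases hij : j = Fin.rev i
    · rw [hij, hred i, mul_zero]
    · simp [cCoeff, hij]
  have ef : ∀ l t, f l t =
      pfaffian (cauchyArray (cCoeff a b p C) p fun i => phi a b p ξ i 0 0 l t) := by
    rw [hf]; exact fun _ _ => rfl
  have eg : ∀ l t, g l t =
      pfaffian (cauchyArray (cCoeff a b p C) p (miwa p a fun i => phi a b p ξ i 0 0 l t)) := by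
    intro l t
    rw [← phi_shift_k, hg]
    rfl
  have ef1 : ∀ l t, f (l + 1) t =
      pfaffian (cauchyArray (cCoeff a b p C) p (miwa p b fun i => phi a b p ξ i 0 0 l t)) := by
    intro l t
    rw [← phi_shift_l hb hb', ef]
  have eg1 : ∀ l t, g (l + 1) t = pfaffian (cauchyArray (cCoeff a b p C) p
      (miwa p a (miwa p b fun i => phi a b p ξ i 0 0 l t))) := by
    intro l t
    rw [← phi_shift_l hb hb', eg]
  have ef0 : ∀ l t, f (l - 1) t =
      pfaffian (cauchyArray (cCoeff a b p C) p (miwa p (-b) fun i => phi a b p ξ i 0 0 l t)) := by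
    intro l t
    rw [← phi_shift_neg_l hb hb', ef]
  have eg0 : ∀ l t, g (l - 1) t = pfaffian (cauchyArray (cCoeff a b p C) p
      (miwa p a (miwa p (-b) fun i => phi a b p ξ i 0 0 l t))) := by
    intro l t
    rw [← phi_shift_neg_l hb hb', eg]
  have ha' : ∀ i, 1 + a * p i ≠ 0 := by
    have h2 := h.2.1
    rw [hg] at h2
    exact one_add_ne_zero_of_tau_ne_zero hc h2
  -- E_l carries a factor b, so b = 0 would force δ_l = 0.
  have hb0 : b ≠ 0 := by
    intro hb0
    apply hodographNum_ne_zero hδ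
    have h1 := h.1
    have h2 := h.2.1
    rw [ef] at h1
    rw [eg] at h2
    rw [hodographNum, ef1, eg1, ef, eg, hodograph_eq_mixed hc hp2 ha hb
      (det_ne_zero_of_pfaffian_ne_zero (cauchyArray_transpose hc _) h1) h2, hb0]
    ring
  refine momentumEquation df dg hb0 (fun l s h => ?_) (fun l s h1 h2 => ?_) h₁ h hδ₁ hδ hM
  · have h1 := h.1
    rw [ef] at h1
    exact miwa_bilinear hc hp hp2 ha hb (hasDerivAt_phi 0 l s) h1
      (funext (ef l)) (funext (eg l)) (funext (ef1 l)) (funext (eg1 l))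
      (df _ s).hasDerivAt (dg _ s).hasDerivAt (df _ s).hasDerivAt (dg _ s).hasDerivAt
  · have dE : ∀ l, Differentiable ℝ (hodographNum a b f g l) := fun l =>
      (((dg _).const_mul _).mul (df _)).sub (((dg _).const_mul _).mul (df _))
    refine hodograph_bilinear hc hp hp2 ha ha' hb hb2 hK (hasDerivAt_phi 0 l s)
      (funext (ef l)) (funext (eg l)) ?_ ?_ h1 h2 (df _ s).hasDerivAt (dg _ s).hasDerivAt
      (dE l s).hasDerivAt (dE (l - 1) s).hasDerivAt
    · funext t
      rw [hodographNum, ef1, eg1]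
    · funext t
      rw [hodographNum, sub_add_cancel, ef0, eg0]

end Soliton

end SemiDiscreteDP

end

theorem theorem2 (N : ℕ) (a b : ℂ) (p ξ C : Fin (2 * N) → ℂ)
    (hp : ∀ i, p i ≠ 0)
    (hpp : ∀ i j, i ≠ j → p i + p j ≠ 0)
    (ha : ∀ i, 1 - a * p i ≠ 0)
    (hb : ∀ i, 1 - b * p i ≠ 0)
    (hb' : ∀ i, 1 + b * p i ≠ 0)
    (hC : ∀ i, C (Fin.rev i) = C i)
    (hred : ∀ i, p i * (1 - a ^ 2 * p i ^ 2) * (1 - b ^ 2 * p (Fin.rev i) ^ 2) +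
      p (Fin.rev i) * (1 - a ^ 2 * p (Fin.rev i) ^ 2) * (1 - b ^ 2 * p i ^ 2) = 0)
    (f g u δ : ℤ → ℝ → ℂ)
    (hf : f = SemiDiscreteDP.fTau a b p ξ C)
    (hg : g = SemiDiscreteDP.gTau a b p ξ C)
    (hu : u = SemiDiscreteDP.uOf f g)
    (hδ : δ = SemiDiscreteDP.deltaOf a b f g) :
    (∀ (l : ℤ) (s : ℝ), SemiDiscreteDP.RegularAt a b f g l s →
      SemiDiscreteDP.MeshEquation u δ l s) ∧
    (∀ (l : ℤ) (s : ℝ), SemiDiscreteDP.RegularAt a b f g (l - 1) s →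
      SemiDiscreteDP.RegularAt a b f g l s →
      δ (l - 1) s ≠ 0 → δ l s ≠ 0 → δ l s + δ (l - 1) s ≠ 0 →
      SemiDiscreteDP.MomentumEquation a u δ l s) := by
  subst hu hδ
  exact SemiDiscreteDP.soliton_solution hp hpp ha hb hb' hC hred hf hg
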